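/- **Setting.** Let $W$ be a mean-zero Gaussian process on a set $\mathcal X$, let $f:\mathcal X\to\mathbb R$ be a fixed function, and for each $n$ let $x_{i,n}\in\mathcal X$, $i\in\iota_n$, be $N_n$ design points, where $N_n=\#\iota_n\to\infty$ (the basic case is $\iota_n=\{1,\dots,n\}$, $N_n=n$; a square grid has $\iota_n=\{1,\dots,n\}^2$, $N_n=n^2$). One observes $Y_{i,n}=f(x_{i,n})+\varepsilon_{i,n}$ with, for each $n$, independent standard normal errors; $P_f$ denotes the resulting probability. Write $\vec f_n=(f(x_{i,n}))_i$, let $U_n$ be the covariance matrix of $(W(x_{i,n}))_i$, with orthonormal eigenbasis $(e_{j,n})_{j\in\iota_n}$ and eigenvalues $\lambda_{j,n}$, and put $f_{j,n}=\vec f_n^Te_{j,n}$ and $Z_{j,n}=\vec\varepsilon_n^Te_{j,n}$. For $m\ge 1$ let $I_n=[\log N_n/N_n,\,N_n^{m-1}]$. For $c\ge0$ let $\Sigma_{n,c}=I+cU_n$ and $\hat f_{n,c}=(I-\Sigma_{n,c}^{-1})\vec Y_n$ (the mean of the posterior law $\mathcal N(\hat f_{n,c},I-\Sigma_{n,c}^{-1})$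 of $\vec f_n$ for the prior $\sqrt c\,W$), and for $\eta\in(0,1)$ let $r_n(c,\eta)$ be the $\eta$-quantile of $\|X\|$ for $X\sim\mathcal N(0,I-\Sigma_{n,c}^{-1})$, with $\|\cdot\|$ the Euclidean norm. The empirical Bayes credible ball is $$\hat C_{n,\eta,M}=\{g:\mathcal X\to\mathbb R:\ \|\vec g_n-\hat f_{n,\hat c_n}\|<M\,r_n(\hat c_n,\eta)\},$$ where $\hat c_n$ is any point of minimum over $c\in I_n$ of, respectively, * (risk-based, $R$) $\ \mathrm{tr}\bigl((I-\Sigma_{n,c}^{-1})^2\bigr)-\mathrm{tr}(\Sigma_{n,c}^{-2})+\vec Y_n^T\Sigma_{n,c}^{-2}\vec Y_n$; * (likelihood-based, $L$) $\ \log\det\Sigma_{n,c}+\vec Y_n^T\Sigma_{n,c}^{-1}\vec Y_n$. With all sums over $j\in\iota_n$, define $$D_{1,n}^R(c)=\sum_j\frac{f_{j,n}^2}{(1+c\lambda_{j,n})^2},\quad D_{2,n}^R(c)=\sum_j\frac{(c\lambda_{j,n})^2}{(1+c\lambda_{j,n})^2},\quad R_{1,n}^R(c)=2\sum_j\frac{Z_{j,n}f_{j,n}}{(1+c\lambda_{j,n})^2},\quad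 R_{2,n}^R(c)=\sum_j(Z_{j,n}^2-1)\Bigl[\frac1{(1+c\lambda_{j,n})^2}-1\Bigr],$$ $$D_{1,n}^L(c)=\sum_j\frac{f_{j,n}^2}{1+c\lambda_{j,n}},\quad D_{2,n}^L(c)=\sum_j\Bigl[\log(1+c\lambda_{j,n})-\frac{c\lambda_{j,n}}{1+c\lambda_{j,n}}\Bigr],\quad R_{1,n}^L(c)=2\sum_j\frac{Z_{j,n}f_{j,n}}{1+c\lambda_{j,n}},\quad R_{2,n}^L(c)=-\sum_j\frac{(Z_{j,n}^2-1)c\lambda_{j,n}}{1+c\lambda_{j,n}},$$ $$R_{3,n}(c)=-2\sum_j\frac{c\lambda_{j,n}Z_{j,n}f_{j,n}}{(1+c\lambda_{j,n})^2},\quad R_{4,n}(c)=\sum_j\frac{(c\lambda_{j,n})^2(Z_{j,n}^2-1)}{(1+c\lambda_{j,n})^2},\quad s_n^2(c)=\sum_j\frac{c\lambda_{j,n}}{1+c\lambda_{j,n}},\quad N_n(c)=\sum_j\frac{c\lambda_{j,n}Z_{j,n}^2}{1+c\lambda_{j,n}}.$$ **Theorem (Coverage).** Fix one of the two methods; let $\hat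 c_n$ be its estimator, let $D_{1,n},D_{2,n},R_{1,n},R_{2,n}$ be its functions and $D_n=D_{1,n}+D_{2,n}$. Suppose that 1. $\displaystyle\sup_{c\in I_n}\frac{|R_{1,n}(c)|+|R_{2,n}(c)|}{D_n(c)}\to0$ and $\displaystyle\sup_{c\in I_n}\frac{|R_{3,n}(c)|+|R_{4,n}(c)|}{D_n(c)}\to0$ in $P_f$-probability; 2. $\displaystyle\sup_{c\in I_n}\Bigl|\frac{N_n(c)}{s_n^2(c)}-1\Bigr|\to0$ in probability; 3. $D_{2,n}^R(c)\asymp D_{2,n}^L(c)\asymp s_n^2(c)$ uniformly in $c\in I_n$, as $n\to\infty$ (the ratios lie between positive constants for all $c\in I_n$ and all sufficiently large $n$); 4. $f$ satisfies the good bias condition: there is $\alpha>0$ such that, for all sufficiently large $n$, $D_{1,n}(Kc)\le K^{-\alpha}D_{1,n}(c)$ for all $c\in I_n$ and all $K>1$; and, for all sufficiently large $n$, $\sum_jf_{j,n}^2\le\sup_{c\in I_n}D_{2,n}(c)$. Then there is $M_0$ such that $P_f(f\in\hat C_{n,\eta,M})\to1$ as $n\to\infty$, for every $M\ge M_0$ and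 every $\eta\in(0,1)$. In particular, the same conclusion holds, with conditions 1, 2 and 3 dropped, if condition 4 holds and for the given $m\ge1$ there are constants $0<\underline\delta\le\overline\delta<\infty$ such that for all sufficiently large $n$ one of the following holds (the same one for all such $n$), after a suitable numbering of the eigenvalues: * $\underline\delta\,N_n/j^m\le\lambda_{j,n}\le\overline\delta\,N_n/j^m$ for $1\le j\le N_n$; * $N_n=k^2$ for an integer $k=k_n$ and $\underline\delta\,k^2/(i^mj^m)\le\lambda_{i,j,n}\le\overline\delta\,k^2/(i^mj^m)$ for $1\le i,j\le k$; * $N_n=k^2$ for an integer $k=k_n$ and $\underline\delta\,k^2/(i^2+j^2)^m\le\lambda_{i,j,n}\le\overline\delta\,k^2/(i^2+j^2)^m$ for $1\le i,j\le k$. -/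

import Mathlib

open MeasureTheory ProbabilityTheory Filter Topology Matrix Set
open scoped ENNReal

noncomputable section

namespace EmpiricalBayes

/-- The two empirical Bayes methods for choosing the scale `c`. -/
inductive EBMethod : Type
  | risk : EBMethod
  | likelihood : EBMethod

section Design

variable {ι : Type*}

/-- Covariance matrix `U` of the unit scale prior process `W` (on the probability space
`(Ω', P')`), restricted to the design points `x i`. -/
def priorCov {𝒳 Ω' : Type*} [MeasurableSpace Ω'] (P' : Measure Ω') (W : 𝒳 → Ω' → ℝ)
    (x : ι → 𝒳) : Matrix ι ι ℝ :=
  Matrix.of fun i j => covariance (W (x i)) (W (x j)) P'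

/-- The interval `I_N = [log N / N, N ^ (m - 1)]` of allowed scales, for sample size `N`. -/
def scaleInterval (m : ℝ) (N : ℕ) : Set ℝ :=
  Icc (Real.log N / N) ((N : ℝ) ^ (m - 1))

variable [Fintype ι]

/-- The coordinates `⟨v, e_j⟩` of a vector `v` relative to an orthonormal basis `e`. -/
def coord (e : OrthonormalBasis ι ℝ (EuclideanSpace ℝ ι)) (v : ι → ℝ) (j : ι) : ℝ :=
  inner ℝ (e j) (WithLp.toLp 2 v)

variable [DecidableEq ι]

/-- `Σ_c = I + c U`. -/
def sigma (U : Matrix ι ι ℝ) (c : ℝ) : Matrix ι ι ℝ := 1 + c • U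

/-- Covariance matrix `I - Σ_c⁻¹` of the posterior law of the vector of function values. -/
def postCov (U : Matrix ι ι ℝ) (c : ℝ) : Matrix ι ι ℝ := 1 - (sigma U c)⁻¹

/-- Posterior mean `(I - Σ_c⁻¹) y` of the vector of function values. -/
def postMean (U : Matrix ι ι ℝ) (c : ℝ) (y : ι → ℝ) : ι → ℝ := postCov U c *ᵥ y

/-- The radius `r(c, η)`: the `η`-quantile of the Euclidean norm of a vector with the
normal law `N(0, I - Σ_c⁻¹)`. -/
def radius (U : Matrix ι ι ℝ) (c η : ℝ) : ℝ :=
  sInf {r : ℝ | 0 ≤ r ∧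
    η ≤ (multivariateGaussian (0 : EuclideanSpace ℝ ι) (postCov U c)).real
      (Metric.closedBall 0 r)}

/-- The credible set with plug-in scale `c`, based on data `y` at design points `x`: all
functions `g` whose vector of values lies within Euclidean distance `M r(c, η)` of the
posterior mean. -/
def credibleSet {𝒳 : Type*} (x : ι → 𝒳) (U : Matrix ι ι ℝ) (c η M : ℝ) (y : ι → ℝ) :
    Set (𝒳 → ℝ) :=
  {g | ‖(WithLp.toLp 2 (fun i => g (x i)) : EuclideanSpace ℝ ι)
        - WithLp.toLp 2 (postMean U c y)‖ < M * radius U c η}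

/-- The criterion (a function of `c`) that is minimised by the empirical Bayes estimator. -/
def criterion (meth : EBMethod) (U : Matrix ι ι ℝ) (y : ι → ℝ) (c : ℝ) : ℝ :=
  match meth with
  | .risk =>
      trace ((1 - (sigma U c)⁻¹) ^ 2) - trace ((sigma U c)⁻¹ ^ 2)
        + y ⬝ᵥ ((sigma U c)⁻¹ ^ 2 *ᵥ y)
  | .likelihood => Real.log (sigma U c).det + y ⬝ᵥ ((sigma U c)⁻¹ *ᵥ y)

/-- `c` is a point of minimum of the criterion over the set `I`. -/
def IsEBEstimate (meth : EBMethod) (U : Matrix ι ι ℝ) (I : Set ℝ) (y : ι → ℝ) (c : ℝ) : Prop :=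
  c ∈ I ∧ IsMinOn (criterion meth U y) I c

end Design

/-! In the following functions `lam j` are the eigenvalues of `U`, and `a j`, `z j` are the
coordinates of the vectors of function values and of errors relative to the eigenbasis. -/

section Criteria

variable {ι : Type*} [Fintype ι]

/-- The bias function `D₁`. -/
def D1 (meth : EBMethod) (lam a : ι → ℝ) (c : ℝ) : ℝ :=
  match meth with
  | .risk => ∑ j, a j ^ 2 / (1 + c * lam j) ^ 2
  | .likelihood => ∑ j, a j ^ 2 / (1 + c * lam j)

/-- The variance function `D₂`. -/
def D2 (meth : EBMethod) (lam : ι → ℝ) (c : ℝ) : ℝ :=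
  match meth with
  | .risk => ∑ j, (c * lam j) ^ 2 / (1 + c * lam j) ^ 2
  | .likelihood => ∑ j, (Real.log (1 + c * lam j) - c * lam j / (1 + c * lam j))

/-- `D = D₁ + D₂`. -/
def D (meth : EBMethod) (lam a : ι → ℝ) (c : ℝ) : ℝ := D1 meth lam a c + D2 meth lam c

/-- The remainder `R₁`. -/
def R1 (meth : EBMethod) (lam a z : ι → ℝ) (c : ℝ) : ℝ :=
  match meth with
  | .risk => 2 * ∑ j, z j * a j / (1 + c * lam j) ^ 2
  | .likelihood => 2 * ∑ j, z j * a j / (1 + c * lam j)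

/-- The remainder `R₂`. -/
def R2 (meth : EBMethod) (lam z : ι → ℝ) (c : ℝ) : ℝ :=
  match meth with
  | .risk => ∑ j, (z j ^ 2 - 1) * (1 / (1 + c * lam j) ^ 2 - 1)
  | .likelihood => -∑ j, (z j ^ 2 - 1) * (c * lam j) / (1 + c * lam j)

/-- The remainder `R₃`. -/
def R3 (lam a z : ι → ℝ) (c : ℝ) : ℝ :=
  -2 * ∑ j, (c * lam j) * z j * a j / (1 + c * lam j) ^ 2

/-- The remainder `R₄`. -/
def R4 (lam z : ι → ℝ) (c : ℝ) : ℝ :=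
  ∑ j, (c * lam j) ^ 2 * (z j ^ 2 - 1) / (1 + c * lam j) ^ 2

/-- The posterior variance `s²`. -/
def sSq (lam : ι → ℝ) (c : ℝ) : ℝ := ∑ j, c * lam j / (1 + c * lam j)

/-- The variable `N(c)`, a weighted sum of squares of standard normal variables. -/
def Nvar (lam z : ι → ℝ) (c : ℝ) : ℝ := ∑ j, c * lam j * z j ^ 2 / (1 + c * lam j)

end Criteria

/-- `sup_{c ∈ I n} |X n c| → 0` in probability; the supremum is taken in `[0, ∞]`. -/
def SupTendstoZeroInProb {Ω : Type*} [MeasurableSpace Ω] (P : Measure Ω) (I : ℕ → Set ℝ)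
    (X : ℕ → ℝ → Ω → ℝ) : Prop :=
  ∀ δ : ℝ, 0 < δ →
    Tendsto (fun n => P {ω | ENNReal.ofReal δ < ⨆ c ∈ I n, ENNReal.ofReal |X n c ω|})
      atTop (𝓝 0)

/-- `u n c ≍ v n c` uniformly in `c ∈ I n`, as `n → ∞`, for nonnegative functions. -/
def UniformAsymp (I : ℕ → Set ℝ) (u v : ℕ → ℝ → ℝ) : Prop :=
  ∃ k K : ℝ, 0 < k ∧ 0 < K ∧
    ∀ᶠ n in atTop, ∀ c ∈ I n, k * v n c ≤ u n c ∧ u n c ≤ K * v n c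

section Arrays

variable {ι : ℕ → Type*} [∀ n, Fintype (ι n)]

/-- The good bias condition relative to the function `D₁` of the given method. -/
def GoodBias (meth : EBMethod) (I : ℕ → Set ℝ) (lam a : ∀ n, ι n → ℝ) : Prop :=
  ∃ α : ℝ, 0 < α ∧ ∀ᶠ n in atTop, ∀ c ∈ I n, ∀ K : ℝ, 1 < K →
    D1 meth (lam n) (a n) (K * c) ≤ K ^ (-α) * D1 meth (lam n) (a n) c

/-- For sample size `N = card (ι n)`, the eigenvalues can be numbered such that
`λ_j ≍ N / j ^ m`, for `j = 1, …, N`. -/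
def PolynomialEigenvalues (m : ℝ) (lam : ∀ n, ι n → ℝ) : Prop :=
  ∃ δ₁ δ₂ : ℝ, 0 < δ₁ ∧ δ₁ ≤ δ₂ ∧ ∀ᶠ n in atTop,
    ∃ num : ι n ≃ Fin (Fintype.card (ι n)), ∀ i,
      δ₁ * ((Fintype.card (ι n) : ℝ) / ((num i : ℕ) + 1 : ℝ) ^ m) ≤ lam n i ∧
      lam n i ≤ δ₂ * ((Fintype.card (ι n) : ℝ) / ((num i : ℕ) + 1 : ℝ) ^ m)

/-- The sample size is a square `k ^ 2`, and the eigenvalues can be numbered such that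
`λ_{i,j} ≍ k ^ 2 / (i ^ m * j ^ m)`, for `i, j = 1, …, k`. -/
def ProductEigenvalues (m : ℝ) (lam : ∀ n, ι n → ℝ) : Prop :=
  ∃ δ₁ δ₂ : ℝ, 0 < δ₁ ∧ δ₁ ≤ δ₂ ∧ ∀ᶠ n in atTop,
    ∃ (k : ℕ) (num : ι n ≃ Fin k × Fin k), ∀ i,
      δ₁ * ((k : ℝ) ^ 2 / ((((num i).1 : ℕ) + 1 : ℝ) ^ m * (((num i).2 : ℕ) + 1 : ℝ) ^ m))
        ≤ lam n i ∧
      lam n i ≤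
        δ₂ * ((k : ℝ) ^ 2 / ((((num i).1 : ℕ) + 1 : ℝ) ^ m * (((num i).2 : ℕ) + 1 : ℝ) ^ m))

/-- The sample size is a square `k ^ 2`, and the eigenvalues can be numbered such that
`λ_{i,j} ≍ k ^ 2 / (i ^ 2 + j ^ 2) ^ m`, for `i, j = 1, …, k`. -/
def SobolevEigenvalues (m : ℝ) (lam : ∀ n, ι n → ℝ) : Prop :=
  ∃ δ₁ δ₂ : ℝ, 0 < δ₁ ∧ δ₁ ≤ δ₂ ∧ ∀ᶠ n in atTop,
    ∃ (k : ℕ) (num : ι n ≃ Fin k × Fin k), ∀ i,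
      δ₁ * ((k : ℝ) ^ 2 /
        ((((num i).1 : ℕ) + 1 : ℝ) ^ 2 + (((num i).2 : ℕ) + 1 : ℝ) ^ 2) ^ m) ≤ lam n i ∧
      lam n i ≤ δ₂ * ((k : ℝ) ^ 2 /
        ((((num i).1 : ℕ) + 1 : ℝ) ^ 2 + (((num i).2 : ℕ) + 1 : ℝ) ^ 2) ^ m)

end Arrays

end EmpiricalBayes

end

namespace EmpiricalBayes

/-! In the eigenbasis everything is diagonal. Up to a term free of `c`, either criterion equals `D +
R1 + R2`, and the squared distance from the truth to the posterior mean is `D .risk + R3 + R4`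
(`criterion_eq`, `norm_sub_postMean_sq`).

Work on the event that both pairs of remainders are at most `D / 4` on the whole range of scales. A
minimiser `c` then nearly minimises `D`. Enlarging `c` by a factor `K` with `K ^ (-α) ≤ 1/4` shrinks
the bias by at least 4 and multiplies the variance by at most `K ^ 2`; since this cannot improve `D`
much, the bias at `c` is at most a multiple of the variance (`D1_le_of_isMinOn`). If `K * c` leaves
the range, the energy condition gives the same bound. Hence the squared distance is `O(s²(c))`. The
squared radius is the `η`-quantile of a variable distributed as `N(c)`, which concentrates at
`s²(c)`, so it eventually exceeds `s²(c) / 2` for every `η`. This gives coverage with a threshold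
for `M` that does not depend on `η` (`mem_credibleSet`, `tendsto_coverage`).

Under the eigenvalue conditions the remainders are controlled directly. On a block of scales from
`c` to `5c/4` they are weighted sums whose weights are power series in `c λ / (1 + c λ)`; Chebyshev
for each power gives a maximal inequality with bound `O(1 / D2 .risk lam c)`
(`measure_exists_block_le`). Along a geometric grid of scales `D2` is bounded below by a multiple of
the effective dimension `(c N) ^ (1/m)`, so the block bounds sum to `O((log N) ^ (-1/m))`. Lattice
point counts (`RegularGrowth`) provide this lower bound on `D2` and the comparison of `D2` with
`s²`. -/

lemma one_add_mul_pos {ι : Type*} {lam : ι → ℝ} {c : ℝ}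
    (hlam : ∀ j, 0 ≤ lam j) (hc : 0 ≤ c) (j : ι) : 0 < 1 + c * lam j := by
  have := mul_nonneg hc (hlam j)
  linarith

/-! ### Diagonalisation of the criteria and of the estimation error. -/

section Spectral

variable {ι : Type*} [Fintype ι]

/-- The orthogonal matrix with columns `e j`. -/
noncomputable def eigenMatrix (e : OrthonormalBasis ι ℝ (EuclideanSpace ℝ ι)) : Matrix ι ι ℝ :=
  Matrix.of fun i j => (e j).ofLp i

variable (e : OrthonormalBasis ι ℝ (EuclideanSpace ℝ ι))

lemma coord_eq_mulVec (v : ι → ℝ) : coord e v = (eigenMatrix e)ᵀ *ᵥ v := by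
  ext j
  simp [coord, eigenMatrix, Matrix.mulVec, dotProduct, PiLp.inner_apply, mul_comm]

lemma coord_add (v w : ι → ℝ) : coord e (fun i => v i + w i) = coord e v + coord e w := by
  rw [coord_eq_mulVec, coord_eq_mulVec, coord_eq_mulVec, ← Matrix.mulVec_add]
  rfl

lemma norm_sq_eq_sum_coord (v : ι → ℝ) :
    ‖(WithLp.toLp 2 v : EuclideanSpace ℝ ι)‖ ^ 2 = ∑ j, coord e v j ^ 2 := by
  rw [← e.sum_sq_norm_inner_right]
  simp [coord]

variable [DecidableEq ι]

lemma transpose_eigenMatrix_mul : (eigenMatrix e)ᵀ * eigenMatrix e = 1 := by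
  ext i j
  have h := orthonormal_iff_ite.1 e.orthonormal i j
  simp only [PiLp.inner_apply, RCLike.inner_apply, conj_trivial] at h
  simp [Matrix.mul_apply, eigenMatrix, Matrix.one_apply, ← h, mul_comm]

lemma eigenMatrix_mul_transpose : eigenMatrix e * (eigenMatrix e)ᵀ = 1 :=
  mul_eq_one_comm.1 (transpose_eigenMatrix_mul e)

/-- The symmetric matrix with eigenbasis `e` and eigenvalues `w`. -/
noncomputable def spectralMatrix (w : ι → ℝ) : Matrix ι ι ℝ :=
  eigenMatrix e * diagonal w * (eigenMatrix e)ᵀ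

lemma spectralMatrix_one : spectralMatrix e 1 = 1 := by
  simp [spectralMatrix, eigenMatrix_mul_transpose]

lemma spectralMatrix_mul (w w' : ι → ℝ) :
    spectralMatrix e w * spectralMatrix e w' = spectralMatrix e (w * w') := by
  have : diagonal w * ((eigenMatrix e)ᵀ * eigenMatrix e) * diagonal w' = diagonal (w * w') := by
    rw [transpose_eigenMatrix_mul, mul_one, diagonal_mul_diagonal]; rfl
  rw [spectralMatrix, spectralMatrix, spectralMatrix, ← this]
  simp only [Matrix.mul_assoc]

lemma spectralMatrix_add (w w' : ι → ℝ) :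
    spectralMatrix e w + spectralMatrix e w' = spectralMatrix e (w + w') := by
  simp only [spectralMatrix, ← Matrix.add_mul, ← Matrix.mul_add, diagonal_add]
  rfl

lemma spectralMatrix_smul (c : ℝ) (w : ι → ℝ) :
    c • spectralMatrix e w = spectralMatrix e (c • w) := by
  simp [spectralMatrix, diagonal_smul]

lemma spectralMatrix_sub (w w' : ι → ℝ) :
    spectralMatrix e w - spectralMatrix e w' = spectralMatrix e (w - w') := by
  simp only [spectralMatrix, ← Matrix.sub_mul, ← Matrix.mul_sub, diagonal_sub]
  rfl

lemma spectralMatrix_inv {w : ι → ℝ} (hw : ∀ j, w j ≠ 0) :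
    (spectralMatrix e w)⁻¹ = spectralMatrix e w⁻¹ := by
  apply Matrix.inv_eq_right_inv
  rw [spectralMatrix_mul, ← spectralMatrix_one e]
  congr 1
  ext j
  simp [hw j]

lemma trace_spectralMatrix (w : ι → ℝ) : trace (spectralMatrix e w) = ∑ j, w j := by
  rw [spectralMatrix, Matrix.trace_mul_comm, ← Matrix.mul_assoc, transpose_eigenMatrix_mul,
    one_mul, trace_diagonal]

lemma det_spectralMatrix (w : ι → ℝ) : (spectralMatrix e w).det = ∏ j, w j := by
  rw [spectralMatrix, Matrix.mul_assoc, Matrix.det_mul_comm, Matrix.mul_assoc,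
    transpose_eigenMatrix_mul, mul_one, det_diagonal]

lemma coord_spectralMatrix_mulVec (w v : ι → ℝ) :
    coord e (spectralMatrix e w *ᵥ v) = w * coord e v := by
  ext j
  rw [coord_eq_mulVec, coord_eq_mulVec, spectralMatrix, Matrix.mulVec_mulVec, ← Matrix.mul_assoc,
    ← Matrix.mul_assoc, transpose_eigenMatrix_mul, one_mul, ← Matrix.mulVec_mulVec,
    Matrix.mulVec_diagonal]
  rfl

lemma dotProduct_spectralMatrix_mulVec (w v : ι → ℝ) :
    v ⬝ᵥ (spectralMatrix e w *ᵥ v) = ∑ j, w j * coord e v j ^ 2 := by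
  rw [spectralMatrix, ← Matrix.mulVec_mulVec, ← Matrix.mulVec_mulVec, Matrix.dotProduct_mulVec,
    ← Matrix.mulVec_transpose, ← coord_eq_mulVec, dotProduct]
  refine Finset.sum_congr rfl fun j _ => ?_
  rw [Matrix.mulVec_diagonal]
  ring

lemma posSemidef_spectralMatrix {w : ι → ℝ} (hw : ∀ j, 0 ≤ w j) :
    (spectralMatrix e w).PosSemidef := by
  have := (Matrix.PosSemidef.diagonal hw).mul_mul_conjTranspose_same (eigenMatrix e)
  simpa [spectralMatrix, Matrix.conjTranspose_eq_transpose_of_trivial] using this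

variable {e} {U : Matrix ι ι ℝ} {lam : ι → ℝ}

lemma eq_spectralMatrix (he : ∀ j, U *ᵥ (e j).ofLp = lam j • (e j).ofLp) :
    U = spectralMatrix e lam := by
  have h : U * eigenMatrix e = eigenMatrix e * diagonal lam := by
    ext i j
    have := congrFun (he j) i
    simp only [Matrix.mulVec, dotProduct, Pi.smul_apply, smul_eq_mul] at this
    rw [Matrix.mul_diagonal, mul_comm]
    simpa [Matrix.mul_apply, eigenMatrix] using this
  rw [spectralMatrix, ← h, Matrix.mul_assoc, eigenMatrix_mul_transpose, mul_one]

lemma sigma_eq_spectralMatrix (hU : U = spectralMatrix e lam) (c : ℝ) :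
    sigma U c = spectralMatrix e (fun j => 1 + c * lam j) := by
  rw [sigma, hU, ← spectralMatrix_one e, spectralMatrix_smul, spectralMatrix_add]
  rfl

variable {c : ℝ}

lemma sigma_inv_eq_spectralMatrix (hU : U = spectralMatrix e lam) (hlam : ∀ j, 0 ≤ lam j)
    (hc : 0 ≤ c) : (sigma U c)⁻¹ = spectralMatrix e (fun j => (1 + c * lam j)⁻¹) := by
  rw [sigma_eq_spectralMatrix hU, spectralMatrix_inv]
  · rfl
  · exact fun j => (one_add_mul_pos hlam hc j).ne'

lemma postCov_eq_spectralMatrix (hU : U = spectralMatrix e lam) (hlam : ∀ j, 0 ≤ lam j)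
    (hc : 0 ≤ c) :
    postCov U c = spectralMatrix e (fun j => c * lam j / (1 + c * lam j)) := by
  rw [postCov, sigma_inv_eq_spectralMatrix hU hlam hc, ← spectralMatrix_one e, spectralMatrix_sub]
  congr 1
  ext j
  have := one_add_mul_pos hlam hc j
  simp only [Pi.sub_apply, Pi.one_apply]
  field_simp
  ring

/-- The constant may depend on the data but not on `c`, so it cancels when two scales are compared.
-/
lemma criterion_eq (meth : EBMethod) (hU : U = spectralMatrix e lam) (hlam : ∀ j, 0 ≤ lam j)
    (v w : ι → ℝ) : ∃ C : ℝ, ∀ c : ℝ, 0 ≤ c →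
      criterion meth U (fun i => v i + w i) c =
        D meth lam (coord e v) c + R1 meth lam (coord e v) (coord e w) c
          + R2 meth lam (coord e w) c + C := by
  cases meth with
  | risk =>
    refine ⟨∑ j, (coord e w j ^ 2 - 1), fun c hc => ?_⟩
    have h1 := postCov_eq_spectralMatrix hU hlam hc
    rw [postCov] at h1
    simp only [criterion, h1]
    rw [sigma_inv_eq_spectralMatrix hU hlam hc, pow_two, pow_two, spectralMatrix_mul,
      spectralMatrix_mul, trace_spectralMatrix, trace_spectralMatrix,
      dotProduct_spectralMatrix_mulVec, coord_add]
    simp only [D, D1, D2, R1, R2, Finset.mul_sum, ← Finset.sum_add_distrib,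
      ← Finset.sum_sub_distrib]
    refine Finset.sum_congr rfl fun j _ => ?_
    have := one_add_mul_pos hlam hc j
    simp only [Pi.mul_apply, Pi.add_apply]
    field_simp
    ring
  | likelihood =>
    refine ⟨∑ j, coord e w j ^ 2, fun c hc => ?_⟩
    simp only [criterion]
    rw [sigma_inv_eq_spectralMatrix hU hlam hc, sigma_eq_spectralMatrix hU, det_spectralMatrix,
      dotProduct_spectralMatrix_mulVec, coord_add,
      Real.log_prod fun j _ => (one_add_mul_pos hlam hc j).ne']
    simp only [D, D1, D2, R1, R2, Finset.mul_sum, ← Finset.sum_add_distrib,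
      ← Finset.sum_neg_distrib]
    refine Finset.sum_congr rfl fun j _ => ?_
    have := one_add_mul_pos hlam hc j
    simp only [Pi.add_apply]
    generalize Real.log (1 + c * lam j) = L
    field_simp
    ring

/-- Each coordinate of the error is a bias `a / (1 + c λ)` minus a noise `c λ z / (1 + c λ)`.
Squaring and writing `z² = 1 + (z² - 1)` produces the risk form of `D`, whichever method selected
`c`. -/
lemma norm_sub_postMean_sq (hU : U = spectralMatrix e lam) (hlam : ∀ j, 0 ≤ lam j) (hc : 0 ≤ c)
    (v w : ι → ℝ) :
    ‖(WithLp.toLp 2 v : EuclideanSpace ℝ ι)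
        - WithLp.toLp 2 (postMean U c (fun i => v i + w i))‖ ^ 2 =
      D .risk lam (coord e v) c + R3 lam (coord e v) (coord e w) c + R4 lam (coord e w) c := by
  rw [← WithLp.toLp_sub, norm_sq_eq_sum_coord e, postMean, postCov_eq_spectralMatrix hU hlam hc]
  have : ∀ u : ι → ℝ, coord e (v - u) = coord e v - coord e u := fun u => by
    simp [coord_eq_mulVec, Matrix.mulVec_sub]
  rw [this, coord_spectralMatrix_mulVec, coord_add]
  simp only [D, D1, D2, R3, R4, Finset.mul_sum, ← Finset.sum_add_distrib]
  refine Finset.sum_congr rfl fun j _ => ?_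
  have := one_add_mul_pos hlam hc j
  simp only [Pi.sub_apply, Pi.mul_apply, Pi.add_apply]
  field_simp
  ring

end Spectral

/-! ### Gaussian laws in the eigenbasis and a lower bound for the radius. -/

section Gaussian

variable {ι : Type*} [Fintype ι]

lemma coord_sum_smul (e : OrthonormalBasis ι ℝ (EuclideanSpace ℝ ι)) (z : ι → ℝ) :
    coord e (∑ j, z j • e j : EuclideanSpace ℝ ι).ofLp = z := by
  ext j
  simp [coord, e.orthonormal.inner_right_fintype]

@[fun_prop]
lemma measurable_coord (e : OrthonormalBasis ι ℝ (EuclideanSpace ℝ ι)) :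
    Measurable (coord e) := by
  refine measurable_pi_lambda _ fun j => ?_
  unfold coord
  fun_prop

/-- The coordinates of a standard normal vector in an orthonormal basis are independent
standard normal. -/
lemma hasLaw_coord {Ω : Type*} [MeasurableSpace Ω] {P : Measure Ω} [IsProbabilityMeasure P]
    {ε : ι → Ω → ℝ} (hε : ∀ i, HasLaw (ε i) (gaussianReal 0 1) P) (hindep : iIndepFun ε P)
    (e : OrthonormalBasis ι ℝ (EuclideanSpace ℝ ι)) :
    HasLaw (fun ω => coord e (fun i => ε i ω)) (Measure.pi fun _ : ι => gaussianReal 0 1) P := by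
  have h := iIndepFun.hasLaw_pi hε hindep
  refine HasLaw.comp (X := fun ω i => ε i ω) (Y := coord e)
    ⟨(measurable_coord e).aemeasurable, ?_⟩ h
  have h1 : (Measure.pi fun _ : ι => gaussianReal 0 1) =
      (stdGaussian (EuclideanSpace ℝ ι)).map WithLp.ofLp := by
    rw [← map_pi_eq_stdGaussian, Measure.map_map (by fun_prop) (by fun_prop)]
    exact Measure.map_id.symm
  conv_lhs => rw [h1]
  rw [stdGaussian_eq_map_pi_orthonormalBasis e, Measure.map_map (by fun_prop) (by fun_prop),
    Measure.map_map (by fun_prop) (by fun_prop)]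
  convert Measure.map_id
  ext1 z
  exact coord_sum_smul e z

open scoped MatrixOrder in
lemma norm_sq_toEuclideanCLM_sqrt [DecidableEq ι] {S : Matrix ι ι ℝ} (hS : S.PosSemidef)
    (v : EuclideanSpace ℝ ι) :
    ‖toEuclideanCLM (𝕜 := ℝ) (CFC.sqrt S) v‖ ^ 2 = v.ofLp ⬝ᵥ (S *ᵥ v.ofLp) := by
  have h : (CFC.sqrt S)ᵀ = CFC.sqrt S := by
    have := (CFC.sqrt_nonneg S).isSelfAdjoint
    rw [IsSelfAdjoint, Matrix.star_eq_conjTranspose,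
      Matrix.conjTranspose_eq_transpose_of_trivial] at this
    exact this
  have h2 : CFC.sqrt S * CFC.sqrt S = S := CFC.sqrt_mul_sqrt_self _ hS.nonneg
  conv_rhs => rw [← h2]
  rw [← Matrix.mulVec_mulVec, Matrix.dotProduct_mulVec, ← Matrix.mulVec_transpose, h,
    EuclideanSpace.real_norm_sq_eq, dotProduct]
  refine Finset.sum_congr rfl fun j _ => ?_
  simp [pow_two]

variable {e : OrthonormalBasis ι ℝ (EuclideanSpace ℝ ι)} {lam : ι → ℝ} {c : ℝ}

lemma measurable_Nvar : Measurable fun z : ι → ℝ => Nvar lam z c := by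
  unfold Nvar
  fun_prop

/-- The eigenvalue is the quadratic form of the covariance at a unit eigenvector, that is, the
variance of a linear combination of values of `W`. -/
lemma eigenvalue_nonneg {𝒳 Ω' : Type*} [MeasurableSpace Ω'] {P' : Measure Ω'}
    [IsProbabilityMeasure P'] {W : 𝒳 → Ω' → ℝ} (hW : ∀ t, MemLp (W t) 2 P') (x : ι → 𝒳)
    (he : ∀ j, priorCov P' W x *ᵥ (e j).ofLp = lam j • (e j).ofLp) (j : ι) : 0 ≤ lam j := by
  have h1 : (e j).ofLp ⬝ᵥ (priorCov P' W x *ᵥ (e j).ofLp) = lam j := by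
    rw [he j, dotProduct_smul]
    have := EuclideanSpace.real_norm_sq_eq (e j)
    rw [e.orthonormal.1 j] at this
    simp only [dotProduct, ← pow_two, ← this]
    simp
  have h2 := variance_fun_sum (μ := P') (X := fun i ω => (e j).ofLp i * W (x i) ω)
    fun i => (hW (x i)).const_mul _
  rw [← h1]
  have h3 := variance_nonneg (fun ω => ∑ i, (e j).ofLp i * W (x i) ω) P'
  rw [h2] at h3
  convert h3 using 1
  simp only [dotProduct, Matrix.mulVec, Finset.mul_sum, priorCov, Matrix.of_apply]
  refine Finset.sum_congr rfl fun i _ => Finset.sum_congr rfl fun k _ => ?_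
  rw [covariance_const_mul_left, covariance_const_mul_right]
  ring

variable [DecidableEq ι] {U : Matrix ι ι ℝ}

/-- The squared norm under the centred posterior law is distributed as `N(c)`: write the vector as
the square root of the covariance applied to a standard normal vector, and expand the latter in the
eigenbasis. -/
lemma multivariateGaussian_postCov (hU : U = spectralMatrix e lam) (hlam : ∀ j, 0 ≤ lam j)
    (hc : 0 ≤ c) {A : Set (EuclideanSpace ℝ ι)} (hA : MeasurableSet A) {B : Set ℝ}
    (hAB : ∀ x, x ∈ A ↔ ‖x‖ ^ 2 ∈ B) :
    multivariateGaussian 0 (postCov U c) A =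
      (Measure.pi fun _ : ι => gaussianReal 0 1) {z | Nvar lam z c ∈ B} := by
  have hS : (postCov U c).PosSemidef := by
    rw [postCov_eq_spectralMatrix hU hlam hc]
    exact posSemidef_spectralMatrix e fun j =>
      div_nonneg (mul_nonneg hc (hlam j)) (one_add_mul_pos hlam hc j).le
  rw [multivariateGaussian, stdGaussian_eq_map_pi_orthonormalBasis e,
    Measure.map_map (by fun_prop) (by fun_prop), Measure.map_apply (by fun_prop) hA]
  congr 1
  ext z
  simp only [mem_preimage, Function.comp_apply, zero_add, hAB, mem_ofPred_eq]
  rw [norm_sq_toEuclideanCLM_sqrt hS, postCov_eq_spectralMatrix hU hlam hc,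
    dotProduct_spectralMatrix_mulVec, coord_sum_smul]
  simp only [Nvar]
  rw [Finset.sum_congr rfl fun j _ => div_mul_eq_mul_div _ _ (z j ^ 2)]

lemma le_radius_sq (hU : U = spectralMatrix e lam) (hlam : ∀ j, 0 ≤ lam j) (hc : 0 ≤ c)
    {η s : ℝ} (hη : η < 1) (hs : 0 ≤ s)
    (h : (Measure.pi fun _ : ι => gaussianReal 0 1) {z | Nvar lam z c < s} < ENNReal.ofReal η) :
    s ≤ radius U c η ^ 2 := by
  suffices √s ≤ radius U c η by
    calc s = √s ^ 2 := (Real.sq_sqrt hs).symm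
      _ ≤ _ := pow_le_pow_left₀ (Real.sqrt_nonneg s) this 2
  refine le_csInf ?_ ?_
  -- The set defining the quantile must be nonempty, as `sInf ∅ = 0` would make the radius vanish;
  -- this is where `η < 1` enters.
  · have ht : Tendsto (fun n : ℕ => multivariateGaussian 0 (postCov U c)
        (Metric.closedBall (0 : EuclideanSpace ℝ ι) n)) atTop (𝓝 1) := by
      have := tendsto_measure_iUnion_atTop (μ := multivariateGaussian 0 (postCov U c))
        (s := fun n : ℕ => Metric.closedBall (0 : EuclideanSpace ℝ ι) n)
        (fun i j hij => Metric.closedBall_subset_closedBall (by exact_mod_cast hij))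
      rwa [Metric.iUnion_closedBall_nat, measure_univ] at this
    have h1 : ENNReal.ofReal η < 1 := by simpa using hη
    obtain ⟨n, hn⟩ := (ht.eventually (lt_mem_nhds h1)).exists
    refine ⟨n, n.cast_nonneg, ?_⟩
    rw [measureReal_def]
    exact (ENNReal.ofReal_le_iff_le_toReal (measure_ne_top _ _)).1 hn.le
  · rintro r ⟨hr0, hr⟩
    by_contra! hlt
    have hr2 : r ^ 2 < s := by
      calc r ^ 2 < √s ^ 2 := pow_lt_pow_left₀ hlt hr0 two_ne_zero
        _ = s := Real.sq_sqrt hs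
    rw [measureReal_def, ← ENNReal.ofReal_le_iff_le_toReal (measure_ne_top _ _),
      multivariateGaussian_postCov hU hlam hc (B := Iic (r ^ 2))
        Metric.isClosed_closedBall.measurableSet] at hr
    · refine (hr.trans (measure_mono fun z hz => ?_)).not_gt h
      exact lt_of_le_of_lt hz hr2
    · intro x
      simp [pow_le_pow_iff_left₀ (norm_nonneg x) hr0 two_ne_zero]

end Gaussian

/-! ### Chebyshev's inequality for weighted sums. -/

section Chebyshev

variable {ι : Type*} [Fintype ι] {μ : Measure ℝ} [IsProbabilityMeasure μ] {φ : ℝ → ℝ}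

lemma measure_le_abs_sum_le (hφ : MemLp φ 2 μ) (hφ0 : ∫ x, φ x ∂μ = 0) (b : ι → ℝ) {t : ℝ}
    (ht : 0 < t) :
    (Measure.pi fun _ : ι => μ) {z | t ≤ |∑ j, φ (z j) * b j|} ≤
      ENNReal.ofReal ((∫ x, φ x ^ 2 ∂μ) * (∑ j, b j ^ 2) / t ^ 2) := by
  have hX : ∀ j : ι, MemLp (fun x => φ x * b j) 2 μ := fun j => hφ.mul_const _
  have hX' : ∀ j : ι, MemLp (fun z : ι → ℝ => φ (z j) * b j) 2 (Measure.pi fun _ : ι => μ) :=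
    fun j => (hX j).comp_measurePreserving (measurePreserving_eval (fun _ : ι => μ) j)
  have hm := meas_ge_le_variance_div_sq (memLp_finsetSum Finset.univ fun j _ => hX' j) ht
  have hv := variance_sum_pi (μ := fun _ : ι => μ) hX
  have hsum : (∑ j : ι, fun z : ι → ℝ => φ (z j) * b j) = fun z => ∑ j, φ (z j) * b j := by
    ext z; simp
  rw [hsum] at hv
  have hi : ∫ z, ∑ j, φ (z j) * b j ∂(Measure.pi fun _ : ι => μ) = 0 := by
    rw [integral_finsetSum _ fun j _ => (hX' j).integrable one_le_two]
    refine Finset.sum_eq_zero fun j _ => ?_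
    rw [integral_comp_eval (μ := fun _ : ι => μ) (i := j) (f := fun x => φ x * b j)
        (hX j).aestronglyMeasurable,
      integral_mul_const, hφ0, zero_mul]
  rw [hi, hv] at hm
  simp only [sub_zero] at hm
  convert hm using 3
  rw [Finset.mul_sum]
  refine Finset.sum_congr rfl fun j _ => ?_
  rw [variance_mul_const, variance_of_integral_eq_zero hφ.aestronglyMeasurable.aemeasurable hφ0]

end Chebyshev

/-! ### Inequalities for the summand of the likelihood variance function, by comparing derivatives
from the origin. -/

section LogPenalty

/-- The summand `log (1 + x) - x / (1 + x)` of the likelihood based variance function. -/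
noncomputable def logPenalty (x : ℝ) : ℝ := Real.log (1 + x) - x / (1 + x)

lemma hasDerivAt_logPenalty {x : ℝ} (hx : 0 ≤ x) :
    HasDerivAt logPenalty (x / (1 + x) ^ 2) x := by
  have h : (1 : ℝ) + x ≠ 0 := by positivity
  have h1 : HasDerivAt (fun y : ℝ => 1 + y) 1 x := (hasDerivAt_id x).const_add 1
  refine ((h1.log h).sub ((hasDerivAt_id x).div h1 h)).congr_deriv ?_
  simp only [id]
  field_simp
  ring

lemma nonneg_of_hasDerivAt_nonneg {f f' : ℝ → ℝ} (h0 : f 0 = 0)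
    (hf : ∀ x, 0 ≤ x → HasDerivAt f (f' x) x) (hf' : ∀ x, 0 ≤ x → 0 ≤ f' x) {x : ℝ} (hx : 0 ≤ x) :
    0 ≤ f x := by
  have hm : MonotoneOn f (Ici 0) := by
    refine monotoneOn_of_deriv_nonneg (convex_Ici 0)
      (fun y hy => (hf y hy).continuousAt.continuousWithinAt) ?_ ?_
    · intro y hy
      rw [interior_Ici] at hy
      exact (hf y (le_of_lt hy)).differentiableAt.differentiableWithinAt
    · intro y hy
      rw [interior_Ici] at hy
      rw [(hf y (le_of_lt hy)).deriv]
      exact hf' y (le_of_lt hy)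
  rw [← h0]
  exact hm self_mem_Ici hx hx

lemma logPenalty_zero : logPenalty 0 = 0 := by simp [logPenalty]

lemma logPenalty_mul_le {K x : ℝ} (hK : 1 ≤ K) (hx : 0 ≤ x) :
    logPenalty (K * x) ≤ K ^ 2 * logPenalty x := by
  have h := nonneg_of_hasDerivAt_nonneg
    (f := fun y => K ^ 2 * logPenalty y - logPenalty (K * y))
    (f' := fun y => K ^ 2 * (y / (1 + y) ^ 2) - K * y / (1 + K * y) ^ 2 * (K * 1))
    (by simp [logPenalty_zero]) (fun y hy => ?_) (fun y hy => ?_) hx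
  · linarith
  · exact ((hasDerivAt_logPenalty hy).const_mul _).sub
      (HasDerivAt.comp y (hasDerivAt_logPenalty (by positivity))
        ((hasDerivAt_id y).const_mul K))
  · have h1 : K * y / (1 + K * y) ^ 2 ≤ K * y / (1 + y) ^ 2 := by
      gcongr
      nlinarith
    have h2 : K * y / (1 + K * y) ^ 2 * (K * 1) ≤ K * y / (1 + y) ^ 2 * (K * 1) := by gcongr
    have h3 : K * y / (1 + y) ^ 2 * (K * 1) = K ^ 2 * (y / (1 + y) ^ 2) := by ring
    linarith

lemma sq_div_le_logPenalty {x : ℝ} (hx : 0 ≤ x) :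
    x ^ 2 / (1 + x) ^ 2 ≤ 2 * logPenalty x := by
  have h := nonneg_of_hasDerivAt_nonneg
    (f := fun y => 2 * logPenalty y - y ^ 2 / (1 + y) ^ 2)
    (f' := fun y => 2 * y ^ 2 / (1 + y) ^ 3)
    (by simp [logPenalty_zero]) (fun y hy => ?_) (fun y hy => by positivity) hx
  · linarith
  · have h : (1 : ℝ) + y ≠ 0 := by positivity
    have h1 : HasDerivAt (fun y : ℝ => 1 + y) 1 y := (hasDerivAt_id y).const_add 1
    refine (((hasDerivAt_logPenalty hy).const_mul 2).sub
      (((hasDerivAt_id y).pow 2).div (h1.pow 2) (pow_ne_zero 2 h))).congr_deriv ?_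
    simp only [id, Pi.pow_apply]
    field_simp
    ring

lemma logPenalty_nonneg {x : ℝ} (hx : 0 ≤ x) : 0 ≤ logPenalty x := by
  have := sq_div_le_logPenalty hx
  have h : 0 ≤ x ^ 2 / (1 + x) ^ 2 := by positivity
  linarith

lemma logPenalty_mono {x y : ℝ} (hx : 0 ≤ x) (hxy : x ≤ y) : logPenalty x ≤ logPenalty y := by
  have h := nonneg_of_hasDerivAt_nonneg
    (f := fun t => logPenalty (x + t) - logPenalty x)
    (f' := fun t => (x + t) / (1 + (x + t)) ^ 2 * 1)
    (by simp) (fun t ht => ?_) (fun t ht => by positivity) (sub_nonneg.2 hxy)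
  · simpa using h
  · exact (HasDerivAt.comp t (hasDerivAt_logPenalty (by positivity))
      ((hasDerivAt_id t).const_add x)).sub_const _

lemma logPenalty_le {x B : ℝ} (hx : 0 ≤ x) (hB : x ≤ B) : logPenalty x ≤ B * (x / (1 + x)) := by
  have h1 : Real.log (1 + x) ≤ x := by
    have := Real.log_le_sub_one_of_pos (show 0 < 1 + x by positivity)
    linarith
  have h2 : x - x / (1 + x) = x * (x / (1 + x)) := by
    field_simp
    ring
  have h3 : x * (x / (1 + x)) ≤ B * (x / (1 + x)) := by gcongr
  unfold logPenalty
  linarith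

lemma div_one_add_mono {x y : ℝ} (hx : 0 ≤ x) (hxy : x ≤ y) : x / (1 + x) ≤ y / (1 + y) := by
  have hy := hx.trans hxy
  rw [div_le_div_iff₀ (by positivity) (by positivity)]
  nlinarith

end LogPenalty

/-! ### Monotonicity and scaling of bias and variance, and the bias bound at a minimiser. -/

section Functions

variable {ι : Type*} [Fintype ι] {lam : ι → ℝ} {c : ℝ}

lemma D2_likelihood_eq : D2 .likelihood lam c = ∑ j, logPenalty (c * lam j) := rfl

lemma D1_nonneg (hlam : ∀ j, 0 ≤ lam j) (hc : 0 ≤ c) (meth : EBMethod) (a : ι → ℝ) :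
    0 ≤ D1 meth lam a c := by
  cases meth <;> refine Finset.sum_nonneg fun j _ => ?_ <;>
    have := one_add_mul_pos hlam hc j <;> positivity

lemma D1_le_sum_sq (hlam : ∀ j, 0 ≤ lam j) (hc : 0 ≤ c) (meth : EBMethod) (a : ι → ℝ) :
    D1 meth lam a c ≤ ∑ j, a j ^ 2 := by
  have h : ∀ j, 1 ≤ 1 + c * lam j := fun j => by
    have := mul_nonneg hc (hlam j)
    linarith
  cases meth <;> refine Finset.sum_le_sum fun j _ => div_le_self (sq_nonneg _) ?_
  · exact one_le_pow₀ (h j)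
  · exact h j

/-- Together with `D2_risk_le`, this bounds the risk form of `D`, which governs the distance, by the
functions of the method in use. -/
lemma D1_risk_le (hlam : ∀ j, 0 ≤ lam j) (hc : 0 ≤ c) (meth : EBMethod) (a : ι → ℝ) :
    D1 .risk lam a c ≤ D1 meth lam a c := by
  cases meth with
  | risk => exact le_rfl
  | likelihood =>
    refine Finset.sum_le_sum fun j _ => ?_
    have := mul_nonneg hc (hlam j)
    gcongr
    nlinarith

lemma half_D1_le (hlam : ∀ j, 0 ≤ lam j) (hc : 0 ≤ c) (meth : EBMethod) (a : ι → ℝ) {u : ℝ}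
    (hu : u ∈ Icc (0 : ℝ) (1 / 4)) :
    D1 meth lam a c / 2 ≤ D1 meth lam a ((1 + u) * c) := by
  have key : ∀ j, 1 + (1 + u) * c * lam j ≤ 5 / 4 * (1 + c * lam j) := fun j => by
    have := mul_nonneg hc (hlam j)
    nlinarith [hu.1, hu.2]
  have pos : ∀ j, 0 < 1 + (1 + u) * c * lam j := fun j =>
    one_add_mul_pos hlam (mul_nonneg (by linarith [hu.1]) hc) j
  cases meth <;> simp only [D1, Finset.sum_div] <;>
    refine Finset.sum_le_sum fun j _ => ?_ <;> rw [div_div] <;>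
    have h := key j <;> have h' := pos j <;> have h'' := one_add_mul_pos hlam hc j <;> gcongr <;>
    nlinarith

lemma D2_nonneg (hlam : ∀ j, 0 ≤ lam j) (hc : 0 ≤ c) (meth : EBMethod) :
    0 ≤ D2 meth lam c := by
  cases meth
  · exact Finset.sum_nonneg fun j _ => by
      have := one_add_mul_pos hlam hc j
      positivity
  · exact Finset.sum_nonneg fun j _ => logPenalty_nonneg (mul_nonneg hc (hlam j))

lemma D2_mono (hlam : ∀ j, 0 ≤ lam j) (hc : 0 ≤ c) (meth : EBMethod) {c' : ℝ} (hcc : c ≤ c') :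
    D2 meth lam c ≤ D2 meth lam c' := by
  have h : ∀ j, c * lam j ≤ c' * lam j := fun j => mul_le_mul_of_nonneg_right hcc (hlam j)
  have h0 : ∀ j, 0 ≤ c * lam j := fun j => mul_nonneg hc (hlam j)
  cases meth
  · refine Finset.sum_le_sum fun j _ => ?_
    rw [← div_pow, ← div_pow]
    exact pow_le_pow_left₀ (div_nonneg (h0 j) (by linarith [h0 j])) (div_one_add_mono (h0 j) (h j)) 2
  · exact Finset.sum_le_sum fun j _ => logPenalty_mono (h0 j) (h j)

lemma D2_mul_le (hlam : ∀ j, 0 ≤ lam j) (hc : 0 ≤ c) (meth : EBMethod) {K : ℝ} (hK : 1 ≤ K) :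
    D2 meth lam (K * c) ≤ K ^ 2 * D2 meth lam c := by
  have h0 : ∀ j, 0 ≤ c * lam j := fun j => mul_nonneg hc (hlam j)
  cases meth
  · simp only [D2, Finset.mul_sum, mul_assoc]
    refine Finset.sum_le_sum fun j _ => ?_
    have := h0 j
    have h1 : 1 + c * lam j ≤ 1 + K * (c * lam j) := by nlinarith
    rw [mul_pow, mul_div_assoc]
    gcongr
  · simp only [D2_likelihood_eq, Finset.mul_sum, mul_assoc]
    exact Finset.sum_le_sum fun j _ => logPenalty_mul_le hK (h0 j)

lemma D2_risk_le (hlam : ∀ j, 0 ≤ lam j) (hc : 0 ≤ c) (meth : EBMethod) :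
    D2 .risk lam c ≤ 2 * D2 meth lam c := by
  cases meth
  · linarith [D2_nonneg hlam hc .risk]
  · simp only [D2_likelihood_eq, Finset.mul_sum]
    exact Finset.sum_le_sum fun j _ => sq_div_le_logPenalty (mul_nonneg hc (hlam j))

lemma D2_risk_le_sSq (hlam : ∀ j, 0 ≤ lam j) (hc : 0 ≤ c) : D2 .risk lam c ≤ sSq lam c := by
  refine Finset.sum_le_sum fun j _ => ?_
  have h := mul_nonneg hc (hlam j)
  rw [div_le_div_iff₀ (by positivity) (by positivity)]
  nlinarith [mul_nonneg h h, mul_nonneg (mul_nonneg h h) h]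

lemma sSq_nonneg (hlam : ∀ j, 0 ≤ lam j) (hc : 0 ≤ c) : 0 ≤ sSq lam c :=
  Finset.sum_nonneg fun j _ => div_nonneg (mul_nonneg hc (hlam j)) (one_add_mul_pos hlam hc j).le

/-- Under the bias and energy conditions, the bias at a near minimiser of `D` is bounded by a
multiple of the variance. -/
lemma D1_le_of_isMinOn (hlam : ∀ j, 0 ≤ lam j) {meth : EBMethod} {a z : ι → ℝ} {lo hi α K : ℝ}
    (hlo : 0 ≤ lo) (hc : c ∈ Icc lo hi) (hK : 1 < K) (hKα : K ^ (-α) ≤ 1 / 4)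
    (hbias : D1 meth lam a (K * c) ≤ K ^ (-α) * D1 meth lam a c)
    (henergy : ∑ j, a j ^ 2 ≤ sSup (D2 meth lam '' Icc lo hi))
    (hR : ∀ c ∈ Icc lo hi, |R1 meth lam a z c| + |R2 meth lam z c| ≤ 1 / 4 * D meth lam a c)
    (hmin : ∀ c' ∈ Icc lo hi, D meth lam a c + R1 meth lam a z c + R2 meth lam z c ≤
      D meth lam a c' + R1 meth lam a z c' + R2 meth lam z c') :
    D1 meth lam a c ≤ 4 * K ^ 2 * D2 meth lam c := by
  have hc0 : 0 ≤ c := hlo.trans hc.1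
  have hD1 := D1_nonneg hlam hc0 meth a
  have hD2 := D2_nonneg hlam hc0 meth
  have hsc := D2_mul_le hlam hc0 meth hK.le
  rcases le_or_gt (K * c) hi with h | h
  -- Near minimality gives `3/4 D(c) ≤ 5/4 D(K c) ≤ 5/4 (D1(c) / 4 + K² D2(c))`; hence `7/16 D1(c) ≤
  -- 5/4 K² D2(c)`, which is stronger than needed.
  · have hKc : K * c ∈ Icc lo hi := ⟨hc.1.trans (by nlinarith), h⟩
    have h1 := hmin _ hKc
    have h2 := hR _ hc
    have h3 := hR _ hKc
    have h4 := abs_le.1 (le_refl |R1 meth lam a z c|)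
    have h5 := abs_le.1 (le_refl |R2 meth lam z c|)
    have h6 := abs_le.1 (le_refl |R1 meth lam a z (K * c)|)
    have h7 := abs_le.1 (le_refl |R2 meth lam z (K * c)|)
    have h8 : K ^ (-α) * D1 meth lam a c ≤ 1 / 4 * D1 meth lam a c := by gcongr
    have h9 : 0 ≤ K ^ 2 * D2 meth lam c := by positivity
    unfold D at h1 h2 h3
    nlinarith [h4.1, h4.2, h5.1, h5.2, h6.1, h6.2, h7.1, h7.2]
  -- When `K * c` is out of range, the total energy is at most `D2(hi) ≤ D2(K c) ≤ K² D2(c)`.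
  · have h1 : sSup (D2 meth lam '' Icc lo hi) ≤ D2 meth lam hi := by
      refine csSup_le ⟨_, mem_image_of_mem _ hc⟩ ?_
      rintro _ ⟨c', hc', rfl⟩
      exact D2_mono hlam (hlo.trans hc'.1) meth hc'.2
    have h2 := D2_mono hlam (hlo.trans (hc.1.trans hc.2)) meth h.le
    have h3 := D1_le_sum_sq hlam hc0 meth a
    have h4 : 0 ≤ K ^ 2 * D2 meth lam c := by positivity
    linarith

end Functions

/-! ### From small remainders to coverage. -/

section Coverage

lemma exists_one_lt_rpow_neg_le {α : ℝ} (hα : 0 < α) : ∃ K : ℝ, 1 < K ∧ K ^ (-α) ≤ 1 / 4 := by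
  have h := (tendsto_rpow_neg_atTop hα).eventually (ge_mem_nhds (show (0 : ℝ) < 1 / 4 by norm_num))
  exact ((eventually_gt_atTop 1).and h).exists

/-- On the event that the remainders are small, the true function is in the credible set. -/
lemma mem_credibleSet {𝒳 ι : Type*} [Fintype ι] [DecidableEq ι] {x : ι → 𝒳} {U : Matrix ι ι ℝ}
    {e : OrthonormalBasis ι ℝ (EuclideanSpace ℝ ι)} {lam : ι → ℝ} (hU : U = spectralMatrix e lam)
    (hlam : ∀ j, 0 ≤ lam j) {meth : EBMethod} {f : 𝒳 → ℝ} {ε : ι → ℝ} {lo hi α K B M η c : ℝ}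
    (hlo : 0 ≤ lo) (hK : 1 < K) (hKα : K ^ (-α) ≤ 1 / 4)
    (hbias : ∀ c ∈ Icc lo hi, D1 meth lam (coord e fun i => f (x i)) (K * c) ≤
      K ^ (-α) * D1 meth lam (coord e fun i => f (x i)) c)
    (henergy : ∑ j, coord e (fun i => f (x i)) j ^ 2 ≤ sSup (D2 meth lam '' Icc lo hi))
    (hB : 0 < B) (hs : ∀ c ∈ Icc lo hi, 0 < sSq lam c ∧ D2 meth lam c ≤ B * sSq lam c)
    (hR12 : ∀ c ∈ Icc lo hi, |R1 meth lam (coord e fun i => f (x i)) (coord e ε) c|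
      + |R2 meth lam (coord e ε) c| ≤ 1 / 4 * D meth lam (coord e fun i => f (x i)) c)
    (hR34 : ∀ c ∈ Icc lo hi, |R3 lam (coord e fun i => f (x i)) (coord e ε) c|
      + |R4 lam (coord e ε) c| ≤ 1 / 4 * D meth lam (coord e fun i => f (x i)) c)
    (hr : ∀ c ∈ Icc lo hi, sSq lam c / 2 ≤ radius U c η ^ 2)
    (hM : 6 * (4 * K ^ 2 + 1) * B + 1 ≤ M)
    (hc : IsEBEstimate meth U (Icc lo hi) (fun i => f (x i) + ε i) c) :
    f ∈ credibleSet x U c η M (fun i => f (x i) + ε i) := by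
  obtain ⟨hcI, hmin⟩ := hc
  have hc0 : 0 ≤ c := hlo.trans hcI.1
  obtain ⟨C, hC⟩ := criterion_eq meth hU hlam (fun i => f (x i)) ε
  have hD1 := D1_le_of_isMinOn hlam hlo hcI hK hKα (hbias c hcI) henergy hR12 fun c' hc' => by
    have h := isMinOn_iff.1 hmin c' hc'
    rw [hC c hc0, hC c' (hlo.trans hc'.1)] at h
    linarith
  have hnorm := norm_sub_postMean_sq hU hlam hc0 (fun i => f (x i)) ε
  set v := ‖(WithLp.toLp 2 (fun i => f (x i)) : EuclideanSpace ℝ ι)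
    - WithLp.toLp 2 (postMean U c fun i => f (x i) + ε i)‖ with hv
  have h1 := D1_risk_le hlam hc0 meth (coord e fun i => f (x i))
  have h2 := D2_risk_le hlam hc0 meth
  have h3 := hR34 c hcI
  obtain ⟨h4, h5⟩ := hs c hcI
  have h6 := le_abs_self (R3 lam (coord e fun i => f (x i)) (coord e ε) c)
  have h7 := le_abs_self (R4 lam (coord e ε) c)
  have h8 := hr c hcI
  have hD2 := D2_nonneg hlam hc0 meth
  have h9 : 0 ≤ D1 meth lam (coord e fun i => f (x i)) c := D1_nonneg hlam hc0 meth _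
  -- Adding the remainders, `v² ≤ (D1 + 2 D2) + (D1 + D2) / 4`, and `D1 ≤ 4 K² D2`.
  have h10 : v ^ 2 ≤ 3 * ((4 * K ^ 2 + 1) * (B * sSq lam c)) := by
    have : (4 * K ^ 2 + 1) * D2 meth lam c ≤ (4 * K ^ 2 + 1) * (B * sSq lam c) := by gcongr
    unfold D at hnorm h3
    linarith
  have hB' : 0 < 6 * (4 * K ^ 2 + 1) * B := by positivity
  have hM1 : 1 ≤ M := by linarith
  -- The extra `+ 1` makes the final inequality strict, because `s²(c) > 0`; it also gives `M ≥ 1`,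
  -- hence `M ≤ M²`.
  have h11 : (6 * (4 * K ^ 2 + 1) * B + 1) * (sSq lam c / 2) ≤ M ^ 2 * radius U c η ^ 2 := by
    have : 6 * (4 * K ^ 2 + 1) * B + 1 ≤ M ^ 2 := hM.trans (by nlinarith)
    gcongr
  have h12 : v ^ 2 < (M * radius U c η) ^ 2 := by
    rw [mul_pow]
    linarith
  have hr0 : 0 ≤ radius U c η := Real.sInf_nonneg fun r hr => hr.1
  exact lt_of_pow_lt_pow_left₀ 2 (mul_nonneg (by linarith) hr0) h12

/-- Coverage, given that the remainders are small compared to `D` on the range of scales, with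
probability tending to one. -/
theorem tendsto_coverage {𝒳 Ω : Type*} [MeasurableSpace Ω] (ι : ℕ → Type*) [∀ n, Fintype (ι n)]
    [∀ n, DecidableEq (ι n)] (x : ∀ n, ι n → 𝒳) (U : ∀ n, Matrix (ι n) (ι n) ℝ)
    (e : ∀ n, OrthonormalBasis (ι n) ℝ (EuclideanSpace ℝ (ι n))) (lam : ∀ n, ι n → ℝ)
    (hU : ∀ n, U n = spectralMatrix (e n) (lam n)) (hlam : ∀ n j, 0 ≤ lam n j)
    (P : Measure Ω) [IsProbabilityMeasure P] (ε : ∀ n, ι n → Ω → ℝ) (f : 𝒳 → ℝ)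
    (meth : EBMethod) (I : ℕ → Set ℝ) (lo hi : ℕ → ℝ) (hI : ∀ n, I n = Icc (lo n) (hi n))
    (hlo : ∀ n, 0 ≤ lo n)
    (a : ∀ n, ι n → ℝ) (ha : ∀ n, a n = coord (e n) (fun i => f (x n i)))
    (Z : ∀ n, Ω → ι n → ℝ) (hZ : ∀ n ω, Z n ω = coord (e n) (fun i => ε n i ω))
    (hbias : GoodBias meth I lam a)
    (henergy : ∀ᶠ n in atTop, ∑ j, a n j ^ 2 ≤ sSup (D2 meth (lam n) '' I n))
    {B : ℝ} (hB : 0 < B)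
    (hs : ∀ᶠ n in atTop, ∀ c ∈ I n,
      0 < sSq (lam n) c ∧ D2 meth (lam n) c ≤ B * sSq (lam n) c)
    (hR12 : Tendsto (fun n => P {ω | ∃ c ∈ I n, 1 / 4 * D meth (lam n) (a n) c <
      |R1 meth (lam n) (a n) (Z n ω) c| + |R2 meth (lam n) (Z n ω) c|}) atTop (𝓝 0))
    (hR34 : Tendsto (fun n => P {ω | ∃ c ∈ I n, 1 / 4 * D meth (lam n) (a n) c <
      |R3 (lam n) (a n) (Z n ω) c| + |R4 (lam n) (Z n ω) c|}) atTop (𝓝 0))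
    (hNv : ∀ η ∈ Ioo (0 : ℝ) 1, ∀ᶠ n in atTop, ∀ c ∈ I n,
      (Measure.pi fun _ : ι n => gaussianReal 0 1) {z | Nvar (lam n) z c < sSq (lam n) c / 2}
        < ENNReal.ofReal η) :
    ∃ M₀ : ℝ, ∀ M : ℝ, M₀ ≤ M → ∀ η ∈ Ioo (0 : ℝ) 1, ∀ chat : ℕ → Ω → ℝ,
      (∀ n ω, IsEBEstimate meth (U n) (I n) (fun i => f (x n i) + ε n i ω) (chat n ω)) →
      Tendsto (fun n => P {ω | f ∈ credibleSet (x n) (U n) (chat n ω) η M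
        (fun i => f (x n i) + ε n i ω)}) atTop (𝓝 1) := by
  obtain ⟨α, hα, hbias⟩ := hbias
  obtain ⟨K, hK, hKα⟩ := exists_one_lt_rpow_neg_le hα
  refine ⟨6 * (4 * K ^ 2 + 1) * B + 1, fun M hM η hη chat hchat => ?_⟩
  have hlim := ENNReal.Tendsto.sub (tendsto_const_nhds (x := (1 : ℝ≥0∞))) (hR12.add hR34)
    (Or.inl ENNReal.one_ne_top)
  simp only [add_zero, tsub_zero] at hlim
  refine tendsto_of_tendsto_of_tendsto_of_le_of_le' hlim tendsto_const_nhds ?_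
    (Eventually.of_forall fun n => prob_le_one)
  filter_upwards [hbias, henergy, hs, hNv η hη] with n hbn hen hsn hNn
  -- The estimator need not be measurable, so complements are avoided: the whole space is covered by
  -- the coverage event and the two bad events, and outer measure is subadditive.
  rw [tsub_le_iff_right, ← measure_univ (μ := P)]
  refine (measure_mono fun ω _ => ?_).trans
    ((measure_union_le _ _).trans (add_le_add_right (measure_union_le _ _) _))
  by_cases h1 : ∃ c ∈ I n, 1 / 4 * D meth (lam n) (a n) c <
      |R1 meth (lam n) (a n) (Z n ω) c| + |R2 meth (lam n) (Z n ω) c|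
  · exact Or.inr (Or.inl h1)
  by_cases h2 : ∃ c ∈ I n, 1 / 4 * D meth (lam n) (a n) c <
      |R3 (lam n) (a n) (Z n ω) c| + |R4 (lam n) (Z n ω) c|
  · exact Or.inr (Or.inr h2)
  left
  push Not at h1 h2
  have hch := hchat n ω
  rw [hI] at h1 h2 hen hch
  simp only [ha, hZ] at h1 h2 hen hbn
  refine mem_credibleSet (hU n) (hlam n) (hlo n) hK hKα (fun c hc => hbn c (hI n ▸ hc) K hK) hen
    hB (fun c hc => hsn c (hI n ▸ hc)) h1 h2 (fun c hc => ?_) hM hch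
  have hc0 := (hlo n).trans hc.1
  exact le_radius_sq (hU n) (hlam n) hc0 hη.2 (by linarith [sSq_nonneg (hlam n) hc0])
    (hNn c (hI n ▸ hc))

end Coverage

/-! ### Consequences of the three general conditions. -/

section GeneralConditions

variable {Ω : Type*} [MeasurableSpace Ω] {P : Measure Ω} {I : ℕ → Set ℝ}

lemma lt_iSup_of_lt_abs {s : Set ℝ} {g : ℝ → ℝ} {δ c : ℝ} (hδ : 0 ≤ δ) (hc : c ∈ s)
    (h : δ < |g c|) : ENNReal.ofReal δ < ⨆ c ∈ s, ENNReal.ofReal |g c| :=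
  ((ENNReal.ofReal_lt_ofReal_iff (hδ.trans_lt h)).2 h).trans_le
    (le_iSup₂ (f := fun c (_ : c ∈ s) => ENNReal.ofReal |g c|) c hc)

lemma SupTendstoZeroInProb.tendsto_exists_lt {T E : ℕ → ℝ → Ω → ℝ}
    (h : SupTendstoZeroInProb P I fun n c ω => T n c ω / E n c ω) (hT : ∀ n c ω, 0 ≤ T n c ω)
    (hE : ∀ᶠ n in atTop, ∀ c ∈ I n, ∀ ω, 0 < E n c ω) {δ : ℝ} (hδ : 0 < δ) :
    Tendsto (fun n => P {ω | ∃ c ∈ I n, δ * E n c ω < T n c ω}) atTop (𝓝 0) := by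
  refine tendsto_of_tendsto_of_tendsto_of_le_of_le' tendsto_const_nhds (h δ hδ)
    (Eventually.of_forall fun n => zero_le) ?_
  filter_upwards [hE] with n hn
  refine measure_mono ?_
  rintro ω ⟨c, hc, hlt⟩
  refine lt_iSup_of_lt_abs (g := fun c => T n c ω / E n c ω) hδ.le hc ?_
  rw [abs_of_nonneg (div_nonneg (hT n c ω) (hn c hc ω).le), lt_div_iff₀ (hn c hc ω)]
  exact hlt

variable {ι : ℕ → Type*} [∀ n, Fintype (ι n)] {lam : ∀ n, ι n → ℝ} {Z : ∀ n, Ω → ι n → ℝ}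

lemma eventually_sSq_pos [IsProbabilityMeasure P] (hlam : ∀ n j, 0 ≤ lam n j)
    (hI : ∀ n, ∀ c ∈ I n, 0 ≤ c)
    (h : SupTendstoZeroInProb P I fun n c ω => Nvar (lam n) (Z n ω) c / sSq (lam n) c - 1) :
    ∀ᶠ n in atTop, ∀ c ∈ I n, 0 < sSq (lam n) c := by
  filter_upwards [(h (1 / 2) (by norm_num)).eventually (gt_mem_nhds zero_lt_one)] with n hn c hc
  -- If `s²(c) = 0`, the quotient is `0` by the convention for division by zero, so its distance to
  -- `1` exceeds `1/2` at every `ω` and the event has probability one.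
  refine (sSq_nonneg (hlam n) (hI n c hc)).lt_of_ne fun h0 => hn.ne ?_
  rw [← measure_univ (μ := P)]
  congr 1
  refine eq_univ_of_forall fun ω => ?_
  refine lt_iSup_of_lt_abs (g := fun c => Nvar (lam n) (Z n ω) c / sSq (lam n) c - 1)
    (by norm_num) hc ?_
  simp only [← h0, div_zero, zero_sub, abs_neg, abs_one]
  norm_num

/-- The radius involves the posterior law rather than the law of the data; since `Z` is also
standard normal, concentration of `N(c)` under `P` transfers to the quantile. -/
lemma eventually_measure_Nvar_lt
    (hZ : ∀ n, HasLaw (Z n) (Measure.pi fun _ : ι n => gaussianReal 0 1) P)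
    (hs : ∀ᶠ n in atTop, ∀ c ∈ I n, 0 < sSq (lam n) c)
    (h : SupTendstoZeroInProb P I fun n c ω => Nvar (lam n) (Z n ω) c / sSq (lam n) c - 1)
    {η : ℝ} (hη : 0 < η) :
    ∀ᶠ n in atTop, ∀ c ∈ I n,
      (Measure.pi fun _ : ι n => gaussianReal 0 1) {z | Nvar (lam n) z c < sSq (lam n) c / 2}
        < ENNReal.ofReal η := by
  filter_upwards [hs, (h (1 / 2) (by norm_num)).eventually
    (gt_mem_nhds (ENNReal.ofReal_pos.2 hη))] with n hsn hn c hc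
  rw [← (hZ n).measure_eq (measurableSet_lt measurable_Nvar measurable_const)]
  refine (measure_mono fun ω hω => ?_).trans_lt hn
  refine lt_iSup_of_lt_abs (g := fun c => Nvar (lam n) (Z n ω) c / sSq (lam n) c - 1)
    (by norm_num) hc ?_
  have h1 : Nvar (lam n) (Z n ω) c / sSq (lam n) c < 1 / 2 := by
    rw [div_lt_iff₀ (hsn c hc)]
    have : Nvar (lam n) (Z n ω) c < sSq (lam n) c / 2 := hω
    linarith
  rw [lt_abs]
  right
  linarith

lemma exists_D2_le_of_uniformAsymp (meth : EBMethod) (hlam : ∀ n j, 0 ≤ lam n j)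
    (hI : ∀ n, ∀ c ∈ I n, 0 ≤ c)
    (hLs : UniformAsymp I (fun n => D2 .likelihood (lam n)) (fun n => sSq (lam n))) :
    ∃ B : ℝ, 0 < B ∧ ∀ᶠ n in atTop, ∀ c ∈ I n, D2 meth (lam n) c ≤ B * sSq (lam n) c := by
  cases meth with
  | risk =>
    refine ⟨1, one_pos, Eventually.of_forall fun n c hc => ?_⟩
    rw [one_mul]
    exact D2_risk_le_sSq (hlam n) (hI n c hc)
  | likelihood =>
    obtain ⟨k, K, -, hK, h⟩ := hLs
    exact ⟨K, hK, h.mono fun n hn c hc => (hn c hc).2⟩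

lemma eventually_D2_pos (meth : EBMethod)
    (hRL : UniformAsymp I (fun n => D2 .risk (lam n)) (fun n => D2 .likelihood (lam n)))
    (hLs : UniformAsymp I (fun n => D2 .likelihood (lam n)) (fun n => sSq (lam n)))
    (hs : ∀ᶠ n in atTop, ∀ c ∈ I n, 0 < sSq (lam n) c) :
    ∀ᶠ n in atTop, ∀ c ∈ I n, 0 < D2 meth (lam n) c := by
  obtain ⟨k, _, hk, _, h⟩ := hLs
  obtain ⟨k', _, hk', _, h'⟩ := hRL
  filter_upwards [h, h', hs] with n hn hn' hsn c hc
  have hL : 0 < D2 .likelihood (lam n) c := (mul_pos hk (hsn c hc)).trans_le (hn c hc).1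
  cases meth
  · exact (mul_pos hk' hL).trans_le (hn' c hc).1
  · exact hL

end GeneralConditions

/-! ### A maximal inequality through power series. -/

section Maximal

variable {ι : Type*} [Fintype ι] {μ : Measure ℝ} [IsProbabilityMeasure μ] {φ : ℝ → ℝ}

/-- A maximal inequality for weighted sums of independent variables, over all weights
`b j * ψ j` in which `ψ j` is the value at `p j` of a power series with coefficients bounded by
`2⁻ˡ`. -/
lemma measure_exists_lt_abs_sum_le (hφ : MemLp φ 2 μ) (hφ0 : ∫ x, φ x ∂μ = 0) (b : ι → ℝ) {p : ι → ℝ}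
    (hp : ∀ j, p j ∈ Icc (0 : ℝ) 1) {t : ℝ} (ht : 0 < t) :
    (Measure.pi fun _ : ι => μ) {z | ∃ (α : ℕ → ℝ) (ψ : ι → ℝ), (∀ l, |α l| ≤ (1 / 2) ^ l) ∧
      (∀ j, HasSum (fun l => α l * p j ^ l) (ψ j)) ∧ t < |∑ j, φ (z j) * (b j * ψ j)|} ≤
      ENNReal.ofReal (32 * ((∫ x, φ x ^ 2 ∂μ) * (∑ j, b j ^ 2) / t ^ 2)) := by
  set Q := (∫ x, φ x ^ 2 ∂μ) * ∑ j, b j ^ 2 with hQ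
  set γ := Measure.pi fun _ : ι => μ
  have hQ0 : 0 ≤ Q := mul_nonneg (integral_nonneg fun x => sq_nonneg _)
    (Finset.sum_nonneg fun j _ => sq_nonneg _)
  -- The thresholds grow like `(3/2)^l`. Against coefficients `(1/2)^l` they sum to `t/4 * ∑ (3/4)^l
  -- = t`, while the Chebyshev bounds decay like `(4/9)^l` and sum to `16 * 9/5 ≤ 32` times `Q /
  -- t²`. The events do not involve the coefficients, so the latter may depend on `z`.
  let A : ℕ → Set (ι → ℝ) := fun l =>
    {z | t / 4 * (3 / 2) ^ l ≤ |∑ j, φ (z j) * (b j * p j ^ l)|}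
  have hsub : {z : ι → ℝ | ∃ (α : ℕ → ℝ) (ψ : ι → ℝ), (∀ l, |α l| ≤ (1 / 2) ^ l) ∧
      (∀ j, HasSum (fun l => α l * p j ^ l) (ψ j)) ∧ t < |∑ j, φ (z j) * (b j * ψ j)|} ⊆
      (⋃ l, A l) := by
    rintro z ⟨α, ψ, hα, hψ, hlt⟩
    by_contra hz
    simp only [mem_iUnion, not_exists, A, mem_ofPred_eq, not_le] at hz
    have h1 : HasSum (fun l => ∑ j, φ (z j) * (b j * (α l * p j ^ l)))
        (∑ j, φ (z j) * (b j * ψ j)) :=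
      hasSum_sum fun j _ => ((hψ j).mul_left (b j)).mul_left (φ (z j))
    have h2 : HasSum (fun l : ℕ => t / 4 * (3 / 4 : ℝ) ^ l) (t / 4 * (1 - 3 / 4)⁻¹) :=
      (hasSum_geometric_of_lt_one (by norm_num) (by norm_num)).mul_left _
    have h3 : ∀ l, ‖∑ j, φ (z j) * (b j * (α l * p j ^ l))‖ ≤ t / 4 * (3 / 4 : ℝ) ^ l := by
      intro l
      have : ∑ j, φ (z j) * (b j * (α l * p j ^ l)) = α l * ∑ j, φ (z j) * (b j * p j ^ l) := by
        rw [Finset.mul_sum]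
        exact Finset.sum_congr rfl fun j _ => by ring
      rw [this, norm_mul, Real.norm_eq_abs, Real.norm_eq_abs]
      calc |α l| * |∑ j, φ (z j) * (b j * p j ^ l)|
          ≤ (1 / 2) ^ l * (t / 4 * (3 / 2) ^ l) :=
            mul_le_mul (hα l) (hz l).le (abs_nonneg _) (by positivity)
        _ = t / 4 * (3 / 4) ^ l := by
            rw [mul_left_comm, ← mul_pow]
            norm_num
    have h4 := tsum_of_norm_bounded h2 h3
    rw [h1.tsum_eq, Real.norm_eq_abs] at h4
    norm_num at h4
    linarith
  have hA : ∀ l, γ (A l) ≤ ENNReal.ofReal (16 * (Q / t ^ 2) * (4 / 9) ^ l) := by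
    intro l
    refine (measure_le_abs_sum_le hφ hφ0 (fun j => b j * p j ^ l) (by positivity)).trans ?_
    refine ENNReal.ofReal_le_ofReal ?_
    have h1 : (∫ x, φ x ^ 2 ∂μ) * ∑ j, (b j * p j ^ l) ^ 2 ≤ Q := by
      refine mul_le_mul_of_nonneg_left (Finset.sum_le_sum fun j _ => ?_)
        (integral_nonneg fun x => sq_nonneg _)
      rw [mul_pow]
      refine mul_le_of_le_one_right (sq_nonneg _) ?_
      exact pow_le_one₀ (pow_nonneg (hp j).1 l) (pow_le_one₀ (hp j).1 (hp j).2)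
    calc _ ≤ Q / (t / 4 * (3 / 2) ^ l) ^ 2 := by gcongr
      _ = 16 * (Q / t ^ 2) * (1 / ((3 / 2) ^ l) ^ 2) := by
          field_simp
          norm_num
      _ = 16 * (Q / t ^ 2) * (4 / 9) ^ l := by
          rw [← pow_mul, mul_comm l 2, pow_mul, ← _root_.one_div_pow]
          norm_num
  refine (measure_mono hsub).trans ((measure_iUnion_le A).trans ?_)
  have hs : HasSum (fun l : ℕ => 16 * (Q / t ^ 2) * (4 / 9 : ℝ) ^ l)
      (16 * (Q / t ^ 2) * (1 - 4 / 9)⁻¹) :=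
    (hasSum_geometric_of_lt_one (by norm_num) (by norm_num)).mul_left _
  refine (ENNReal.tsum_le_tsum hA).trans ?_
  rw [← ENNReal.ofReal_tsum_of_nonneg (fun l => by positivity) hs.summable, hs.tsum_eq]
  refine ENNReal.ofReal_le_ofReal ?_
  have : 0 ≤ Q / t ^ 2 := by positivity
  norm_num
  linarith

lemma hasSum_inv_pow {u p : ℝ} (hu : u ∈ Icc (0 : ℝ) (1 / 4)) (hp : p ∈ Icc (0 : ℝ) 1) (k : ℕ) :
    HasSum (fun l : ℕ => ((l + k).choose k : ℝ) * (-u) ^ l * p ^ l) (1 / (1 + u * p) ^ (k + 1)) := by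
  have h1 : ‖-(u * p)‖ < 1 := by
    rw [norm_neg, Real.norm_eq_abs, abs_of_nonneg (mul_nonneg hu.1 hp.1)]
    nlinarith [hu.1, hu.2, hp.1, hp.2]
  have h2 := hasSum_choose_mul_geometric_of_norm_lt_one k h1
  rw [sub_neg_eq_add] at h2
  refine h2.congr_fun fun l => ?_
  rw [mul_assoc, ← mul_pow, neg_mul]

/-- The binomial coefficient is `1` or `l + 1`, hence at most `2^l`, while `u^l ≤ 4^(-l)`. This is
why blocks of scales have ratio `5/4`. -/
lemma abs_choose_mul_pow_le {u : ℝ} (hu : u ∈ Icc (0 : ℝ) (1 / 4)) {k : ℕ} (hk : k ≤ 1) (l : ℕ) :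
    |((l + k).choose k : ℝ) * (-u) ^ l| ≤ (1 / 2) ^ l := by
  have h1 : ((l + k).choose k : ℝ) ≤ 2 ^ l := by
    have : (l + k).choose k ≤ 2 ^ l := by
      interval_cases k
      · simpa using Nat.one_le_two_pow
      · simpa using Nat.lt_two_pow_self
    exact_mod_cast this
  rw [abs_mul, abs_pow, abs_neg, abs_of_nonneg hu.1, Nat.abs_cast]
  calc ((l + k).choose k : ℝ) * u ^ l ≤ 2 ^ l * (1 / 4) ^ l :=
        mul_le_mul h1 (pow_le_pow_left₀ hu.1 hu.2 l) (pow_nonneg hu.1 l) (by positivity)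
    _ = (1 / 2) ^ l := by
        rw [← mul_pow]
        norm_num

/-- The form in which the remainders on a block appear. The factor `s u` carries the powers of `1 +
u` from numerators, normalised to be at most one; the normalising constant goes into `b`. -/
lemma measure_exists_scale_le (hφ : MemLp φ 2 μ) (hφ0 : ∫ x, φ x ∂μ = 0) (b : ι → ℝ) {p : ι → ℝ}
    (hp : ∀ j, p j ∈ Icc (0 : ℝ) 1) {t : ℝ} (ht : 0 < t) {k : ℕ} (hk : k ≤ 1) {s : ℝ → ℝ}
    (hs : ∀ u ∈ Icc (0 : ℝ) (1 / 4), |s u| ≤ 1) {T : ℝ → (ι → ℝ) → ℝ}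
    (hT : ∀ u ∈ Icc (0 : ℝ) (1 / 4), ∀ z,
      T u z = ∑ j, φ (z j) * (b j * (s u / (1 + u * p j) ^ (k + 1)))) :
    (Measure.pi fun _ : ι => μ) {z | ∃ u ∈ Icc (0 : ℝ) (1 / 4), t < |T u z|} ≤
      ENNReal.ofReal (32 * ((∫ x, φ x ^ 2 ∂μ) * (∑ j, b j ^ 2) / t ^ 2)) := by
  refine (measure_mono ?_).trans (measure_exists_lt_abs_sum_le hφ hφ0 b hp ht)
  rintro z ⟨u, hu, hlt⟩
  refine ⟨fun l => s u * (((l + k).choose k : ℝ) * (-u) ^ l), _, fun l => ?_, fun j => ?_,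
    (hT u hu z) ▸ hlt⟩
  · rw [abs_mul]
    exact (mul_le_of_le_one_left (abs_nonneg _) (hs u hu)).trans (abs_choose_mul_pow_le hu hk l)
  · have := (hasSum_inv_pow hu (hp j) k).mul_left (s u)
    simpa only [mul_assoc, mul_one_div] using this

end Maximal

/-! ### Uniform control of the remainders over blocks of scales. -/

section Block

variable {ι : Type*} {lam : ι → ℝ} {c : ℝ}

/-- Separates the base scale from the position `u` in the block, with `c λ / (1 + c λ)` in `[0, 1]`
as power series variable. -/
lemma one_add_scale_eq (hlam : ∀ j, 0 ≤ lam j) (hc : 0 ≤ c) (u : ℝ) (j : ι) :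
    1 + (1 + u) * c * lam j =
      (1 + c * lam j) * (1 + u * (c * lam j / (1 + c * lam j))) := by
  have := one_add_mul_pos hlam hc j
  field_simp
  ring

lemma ratio_mem_Icc (hlam : ∀ j, 0 ≤ lam j) (hc : 0 ≤ c) (j : ι) :
    c * lam j / (1 + c * lam j) ∈ Icc (0 : ℝ) 1 := by
  have := mul_nonneg hc (hlam j)
  refine ⟨by positivity, ?_⟩
  rw [div_le_one (by positivity)]
  linarith

lemma one_add_scale_ratio_pos (hlam : ∀ j, 0 ≤ lam j) (hc : 0 ≤ c) {u : ℝ} (hu : 0 ≤ u) (j : ι) :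
    0 < 1 + u * (c * lam j / (1 + c * lam j)) := by
  have := mul_nonneg hu (ratio_mem_Icc hlam hc j).1
  linarith

variable [Fintype ι]

lemma memLp_sq_sub_one : MemLp (fun x : ℝ => x ^ 2 - 1) 2 (gaussianReal 0 1) := by
  refine MemLp.sub ?_ (memLp_const 1)
  rw [memLp_two_iff_integrable_sq (by fun_prop)]
  have h := (memLp_id_gaussianReal (μ := 0) (v := 1) 4).integrable_norm_pow (p := 4) (by norm_num)
  refine h.congr (Eventually.of_forall fun x => ?_)
  simp only [id, Real.norm_eq_abs]
  rw [← pow_mul, Even.pow_abs (by decide)]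

lemma integral_sq_sub_one : ∫ x, (x ^ 2 - 1) ∂(gaussianReal 0 1) = 0 := by
  have h : MemLp (fun x : ℝ => x) 2 (gaussianReal 0 1) := memLp_id_gaussianReal 2
  have h1 := variance_of_integral_eq_zero (μ := gaussianReal 0 1) (X := fun x => x)
    (by fun_prop) (by simp)
  rw [variance_fun_id_gaussianReal] at h1
  rw [integral_sub h.integrable_sq (integrable_const 1), ← h1]
  simp

/-- The sum of the second moments of `X` and `X ^ 2 - 1` for a standard normal `X`. -/
noncomputable def momentBound : ℝ :=
  (∫ x, x ^ 2 ∂(gaussianReal 0 1)) + ∫ x, (x ^ 2 - 1) ^ 2 ∂(gaussianReal 0 1)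

lemma integral_sq_le_momentBound : ∫ x, x ^ 2 ∂(gaussianReal 0 1) ≤ momentBound :=
  le_add_of_nonneg_right (integral_nonneg fun x => sq_nonneg (x ^ 2 - 1))

lemma integral_sq_sub_one_sq_le_momentBound :
    ∫ x, (x ^ 2 - 1) ^ 2 ∂(gaussianReal 0 1) ≤ momentBound :=
  le_add_of_nonneg_left (integral_nonneg fun x => sq_nonneg x)

lemma momentBound_nonneg : 0 ≤ momentBound :=
  (integral_nonneg fun x => sq_nonneg x).trans integral_sq_le_momentBound

/-- Reduces the risk version of `R2` to two sums of the form covered by the maximal inequality. -/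
lemma R2_risk_eq (hlam : ∀ j, 0 ≤ lam j) (hc : 0 ≤ c) (z : ι → ℝ) :
    R2 .risk lam z c = R4 lam z c + 2 * R2 .likelihood lam z c := by
  simp only [R2, R4, ← Finset.sum_neg_distrib, Finset.mul_sum, ← Finset.sum_add_distrib]
  refine Finset.sum_congr rfl fun j _ => ?_
  have := one_add_mul_pos hlam hc j
  field_simp
  ring

lemma measure_R1_le (meth : EBMethod) (hlam : ∀ j, 0 ≤ lam j) (hc : 0 ≤ c) (a : ι → ℝ) {t : ℝ}
    (ht : 0 < t) :
    (Measure.pi fun _ : ι => gaussianReal 0 1)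
      {z | ∃ u ∈ Icc (0 : ℝ) (1 / 4), t < |R1 meth lam a z ((1 + u) * c)|} ≤
      ENNReal.ofReal (32 * (momentBound * (4 * D1 meth lam a c) / t ^ 2)) := by
  have hx : MemLp (fun x : ℝ => x) 2 (gaussianReal 0 1) := memLp_id_gaussianReal 2
  cases meth with
  | risk =>
    have h := measure_exists_scale_le hx (by simp)
      (fun j => 2 * a j / (1 + c * lam j) ^ 2) (ratio_mem_Icc hlam hc) ht le_rfl
      (s := fun _ => 1) (T := fun u z => R1 .risk lam a z ((1 + u) * c))
      (fun u hu => by simp) (fun u hu z => ?_)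
    · refine h.trans (ENNReal.ofReal_le_ofReal ?_)
      gcongr
      · exact momentBound_nonneg
      · exact integral_sq_le_momentBound
      · simp only [D1, Finset.mul_sum]
        refine Finset.sum_le_sum fun j _ => ?_
        have h1 : 1 ≤ (1 + c * lam j) ^ 2 := one_le_pow₀ (by linarith [mul_nonneg hc (hlam j)])
        generalize (1 + c * lam j) ^ 2 = w at h1 ⊢
        rw [div_pow, mul_pow, mul_div_assoc]
        norm_num
        gcongr
        nlinarith
    · simp only [R1, Finset.mul_sum]
      refine Finset.sum_congr rfl fun j _ => ?_
      have h1 := one_add_mul_pos hlam hc j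
      have h2 := one_add_scale_ratio_pos hlam hc hu.1 j
      rw [one_add_scale_eq hlam hc]
      generalize 1 + u * (c * lam j / (1 + c * lam j)) = w at h2 ⊢
      field_simp
  | likelihood =>
    have h := measure_exists_scale_le hx (by simp)
      (fun j => 2 * a j / (1 + c * lam j)) (ratio_mem_Icc hlam hc) ht zero_le_one
      (s := fun _ => 1) (T := fun u z => R1 .likelihood lam a z ((1 + u) * c))
      (fun u hu => by simp) (fun u hu z => ?_)
    · refine h.trans (ENNReal.ofReal_le_ofReal ?_)
      gcongr
      · exact momentBound_nonneg
      · exact integral_sq_le_momentBound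
      · simp only [D1, Finset.mul_sum]
        refine Finset.sum_le_sum fun j _ => ?_
        have h1 : 1 ≤ 1 + c * lam j := by linarith [mul_nonneg hc (hlam j)]
        rw [div_pow, mul_pow, mul_div_assoc]
        norm_num
        gcongr
        nlinarith
    · simp only [R1, Finset.mul_sum]
      refine Finset.sum_congr rfl fun j _ => ?_
      have h1 := one_add_mul_pos hlam hc j
      have h2 := one_add_scale_ratio_pos hlam hc hu.1 j
      rw [one_add_scale_eq hlam hc]
      generalize 1 + u * (c * lam j / (1 + c * lam j)) = w at h2 ⊢
      field_simp
      ring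

lemma measure_R3_le (hlam : ∀ j, 0 ≤ lam j) (hc : 0 ≤ c) (a : ι → ℝ) {t : ℝ}
    (ht : 0 < t) :
    (Measure.pi fun _ : ι => gaussianReal 0 1)
      {z | ∃ u ∈ Icc (0 : ℝ) (1 / 4), t < |R3 lam a z ((1 + u) * c)|} ≤
      ENNReal.ofReal (32 * (momentBound * (16 * D1 .risk lam a c) / t ^ 2)) := by
  have hx : MemLp (fun x : ℝ => x) 2 (gaussianReal 0 1) := memLp_id_gaussianReal 2
  have h := measure_exists_scale_le hx (by simp)
    (fun j => -4 * (a j / (1 + c * lam j)) * (c * lam j / (1 + c * lam j))) (ratio_mem_Icc hlam hc)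
    ht le_rfl (s := fun u => (1 + u) / 2) (T := fun u z => R3 lam a z ((1 + u) * c))
    (fun u hu => ?_) (fun u hu z => ?_)
  · refine h.trans (ENNReal.ofReal_le_ofReal ?_)
    gcongr
    · exact momentBound_nonneg
    · exact integral_sq_le_momentBound
    · simp only [D1, Finset.mul_sum]
      refine Finset.sum_le_sum fun j _ => ?_
      obtain ⟨h0, h1⟩ := ratio_mem_Icc hlam hc j
      rw [← div_pow, mul_pow, mul_pow]
      have := mul_le_mul_of_nonneg_left (pow_le_one₀ h0 h1 (n := 2))
        (sq_nonneg (a j / (1 + c * lam j)))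
      linarith
  · rw [abs_le]
    constructor <;> linarith [hu.1, hu.2]
  · simp only [R3, Finset.mul_sum]
    refine Finset.sum_congr rfl fun j _ => ?_
    have h1 := one_add_mul_pos hlam hc j
    have h2 := one_add_scale_ratio_pos hlam hc hu.1 j
    rw [one_add_scale_eq hlam hc]
    generalize 1 + u * (c * lam j / (1 + c * lam j)) = w at h2 ⊢
    field_simp
    ring

lemma measure_R2_likelihood_le (hlam : ∀ j, 0 ≤ lam j) (hc : 0 ≤ c) {t : ℝ} (ht : 0 < t) :
    (Measure.pi fun _ : ι => gaussianReal 0 1)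
      {z | ∃ u ∈ Icc (0 : ℝ) (1 / 4), t < |R2 .likelihood lam z ((1 + u) * c)|} ≤
      ENNReal.ofReal (32 * (momentBound * (4 * D2 .risk lam c) / t ^ 2)) := by
  have h := measure_exists_scale_le memLp_sq_sub_one integral_sq_sub_one
    (fun j => -2 * (c * lam j / (1 + c * lam j))) (ratio_mem_Icc hlam hc) ht zero_le_one
    (s := fun u => (1 + u) / 2) (T := fun u z => R2 .likelihood lam z ((1 + u) * c))
    (fun u hu => ?_) (fun u hu z => ?_)
  · refine h.trans (ENNReal.ofReal_le_ofReal ?_)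
    gcongr
    · exact momentBound_nonneg
    · exact integral_sq_sub_one_sq_le_momentBound
    · simp only [D2, Finset.mul_sum]
      refine Finset.sum_le_sum fun j _ => ?_
      rw [← div_pow]
      linarith
  · rw [abs_le]
    constructor <;> linarith [hu.1, hu.2]
  · simp only [R2, ← Finset.sum_neg_distrib]
    refine Finset.sum_congr rfl fun j _ => ?_
    have h1 := one_add_mul_pos hlam hc j
    have h2 := one_add_scale_ratio_pos hlam hc hu.1 j
    rw [one_add_scale_eq hlam hc]
    generalize 1 + u * (c * lam j / (1 + c * lam j)) = w at h2 ⊢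
    field_simp
    ring

lemma measure_R4_le (hlam : ∀ j, 0 ≤ lam j) (hc : 0 ≤ c) {t : ℝ} (ht : 0 < t) :
    (Measure.pi fun _ : ι => gaussianReal 0 1)
      {z | ∃ u ∈ Icc (0 : ℝ) (1 / 4), t < |R4 lam z ((1 + u) * c)|} ≤
      ENNReal.ofReal (32 * (momentBound * (4 * D2 .risk lam c) / t ^ 2)) := by
  have h := measure_exists_scale_le memLp_sq_sub_one integral_sq_sub_one
    (fun j => 2 * (c * lam j / (1 + c * lam j)) ^ 2) (ratio_mem_Icc hlam hc) ht le_rfl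
    (s := fun u => (1 + u) ^ 2 / 2) (T := fun u z => R4 lam z ((1 + u) * c))
    (fun u hu => ?_) (fun u hu z => ?_)
  · refine h.trans (ENNReal.ofReal_le_ofReal ?_)
    gcongr
    · exact momentBound_nonneg
    · exact integral_sq_sub_one_sq_le_momentBound
    · simp only [D2, Finset.mul_sum]
      refine Finset.sum_le_sum fun j _ => ?_
      obtain ⟨h0, h1⟩ := ratio_mem_Icc hlam hc j
      rw [← div_pow]
      nlinarith [pow_le_one₀ h0 h1 (n := 2), sq_nonneg (c * lam j / (1 + c * lam j))]
  · rw [abs_le]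
    constructor <;> nlinarith [hu.1, hu.2]
  · simp only [R4]
    refine Finset.sum_congr rfl fun j _ => ?_
    have h1 := one_add_mul_pos hlam hc j
    have h2 := one_add_scale_ratio_pos hlam hc hu.1 j
    rw [one_add_scale_eq hlam hc]
    generalize 1 + u * (c * lam j / (1 + c * lam j)) = w at h2 ⊢
    field_simp

/-- Both remainders are at most a quarter of `D`, with large probability, uniformly in scales
between `c` and `5 c / 4`. -/
lemma measure_exists_block_le (meth : EBMethod) (hlam : ∀ j, 0 ≤ lam j) (hc : 0 ≤ c) (a : ι → ℝ)
    (hD : 0 < D2 .risk lam c) :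
    (Measure.pi fun _ : ι => gaussianReal 0 1) {z | ∃ u ∈ Icc (0 : ℝ) (1 / 4),
      1 / 4 * D meth lam a ((1 + u) * c) <
        |R1 meth lam a z ((1 + u) * c)| + |R2 meth lam z ((1 + u) * c)| ∨
      1 / 4 * D meth lam a ((1 + u) * c) <
        |R3 lam a z ((1 + u) * c)| + |R4 lam z ((1 + u) * c)|} ≤
      ENNReal.ofReal (2 ^ 23 * momentBound / D2 .risk lam c) := by
  set D₀ := D meth lam a c with hD₀
  have h1 := D1_nonneg hlam hc meth a
  have h2 := D1_risk_le hlam hc meth a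
  have h3 := D2_risk_le hlam hc meth
  have h4 : D2 .risk lam c ≤ 2 * D₀ := by
    rw [hD₀, D]
    linarith
  have h5 := momentBound_nonneg
  have hpos : 0 < D₀ := by linarith
  -- If the four basic sums are at most `D₀ / 32`, then `|R1| + |R2| ≤ (1 + 3) D₀ / 32 = D₀ / 8`,
  -- and `D₀ / 2` is a lower bound for `D` on the block.
  have ht : 0 < D₀ / 32 := by linarith
  have hle : ∀ q, q ≤ 32 * D₀ → ENNReal.ofReal (32 * (momentBound * q / (D₀ / 32) ^ 2)) ≤
      ENNReal.ofReal (2 ^ 21 * momentBound / D2 .risk lam c) := by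
    intro q hq
    refine ENNReal.ofReal_le_ofReal ?_
    calc 32 * (momentBound * q / (D₀ / 32) ^ 2)
        ≤ 32 * (momentBound * (32 * D₀) / (D₀ / 32) ^ 2) := by gcongr
      _ = 2 ^ 21 * momentBound / (2 * D₀) := by
          field_simp
          norm_num
          ring
      _ ≤ 2 ^ 21 * momentBound / D2 .risk lam c := by gcongr
  have b1 := (measure_R1_le meth hlam hc a ht).trans (hle _ (by rw [hD₀, D]; linarith))
  have b2 := (measure_R3_le hlam hc a ht).trans (hle _ (by rw [hD₀, D]; linarith))
  have b3 := (measure_R2_likelihood_le hlam hc ht).trans (hle _ (by linarith))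
  have b4 := (measure_R4_le hlam hc ht).trans (hle _ (by linarith))
  have key : ENNReal.ofReal (2 ^ 23 * momentBound / D2 .risk lam c) =
      ENNReal.ofReal (2 ^ 21 * momentBound / D2 .risk lam c) +
      ENNReal.ofReal (2 ^ 21 * momentBound / D2 .risk lam c) +
      ENNReal.ofReal (2 ^ 21 * momentBound / D2 .risk lam c) +
      ENNReal.ofReal (2 ^ 21 * momentBound / D2 .risk lam c) := by
    have : 0 ≤ 2 ^ 21 * momentBound / D2 .risk lam c := by positivity
    rw [← ENNReal.ofReal_add this this, ← ENNReal.ofReal_add (by positivity) this,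
      ← ENNReal.ofReal_add (by positivity) this]
    congr 1
    ring
  rw [key]
  refine (measure_mono ?_).trans ((measure_union_le _ _).trans (add_le_add
    ((measure_union_le _ _).trans (add_le_add ((measure_union_le _ _).trans (add_le_add b1 b2)) b3))
    b4))
  rintro z ⟨u, hu, hz⟩
  by_contra hn
  simp only [mem_union, not_or, mem_ofPred_eq, not_exists, not_and, not_lt] at hn
  obtain ⟨⟨⟨n1, n2⟩, n3⟩, n4⟩ := hn
  have hDu : D₀ / 2 ≤ D meth lam a ((1 + u) * c) := by
    have e1 := half_D1_le hlam hc meth a hu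
    have e2 := D2_mono hlam hc meth (c' := (1 + u) * c) (by nlinarith [hu.1])
    have e3 := D2_nonneg hlam hc meth
    rw [hD₀, D, D]
    linarith
  have m1 := n1 u hu
  have m2 := n2 u hu
  have m3 := n3 u hu
  have m4 := n4 u hu
  have m5 : |R2 meth lam z ((1 + u) * c)| ≤ D₀ / 32 + 2 * (D₀ / 32) := by
    cases meth with
    | risk =>
      rw [R2_risk_eq hlam (mul_nonneg (by linarith [hu.1]) hc)]
      refine (abs_add_le _ _).trans (add_le_add m4 ?_)
      rw [abs_mul, abs_two]
      linarith
    | likelihood => linarith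
  rcases hz with hz | hz <;> linarith

/-- The remainders are at most a quarter of `D`, with large probability, uniformly over an
interval of scales on which `D₂` grows at least polynomially. -/
lemma measure_exists_interval_le (meth : EBMethod) (hlam : ∀ j, 0 ≤ lam j) (a : ι → ℝ)
    {lo hi A ρ : ℝ} (hlo : 0 < lo) (hA : 0 < A) (hρ : 1 < ρ)
    (hD : ∀ k : ℕ, lo * (5 / 4) ^ k ≤ hi → A * ρ ^ k ≤ D2 .risk lam (lo * (5 / 4) ^ k)) :
    (Measure.pi fun _ : ι => gaussianReal 0 1) {z | ∃ c ∈ Icc lo hi,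
      1 / 4 * D meth lam a c < |R1 meth lam a z c| + |R2 meth lam z c| ∨
      1 / 4 * D meth lam a c < |R3 lam a z c| + |R4 lam z c|} ≤
      ENNReal.ofReal (2 ^ 23 * momentBound / A * (1 - ρ⁻¹)⁻¹) := by
  have hρ0 : 0 < ρ := one_pos.trans hρ
  have h5 := momentBound_nonneg
  -- Bad event of the `k`-th block. The guard empties it beyond `hi`, where no lower bound on `D2`
  -- is available, so one geometric series bounds any number of blocks.
  let S : ℕ → Set (ι → ℝ) := fun k => {z | lo * (5 / 4) ^ k ≤ hi ∧ ∃ u ∈ Icc (0 : ℝ) (1 / 4),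
      1 / 4 * D meth lam a ((1 + u) * (lo * (5 / 4) ^ k)) <
        |R1 meth lam a z ((1 + u) * (lo * (5 / 4) ^ k))|
          + |R2 meth lam z ((1 + u) * (lo * (5 / 4) ^ k))| ∨
      1 / 4 * D meth lam a ((1 + u) * (lo * (5 / 4) ^ k)) <
        |R3 lam a z ((1 + u) * (lo * (5 / 4) ^ k))| + |R4 lam z ((1 + u) * (lo * (5 / 4) ^ k))|}
  have hS : ∀ k, (Measure.pi fun _ : ι => gaussianReal 0 1) (S k) ≤
      ENNReal.ofReal (2 ^ 23 * momentBound / A * ρ⁻¹ ^ k) := by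
    intro k
    by_cases hk : lo * (5 / 4) ^ k ≤ hi
    · have hpos : 0 < A * ρ ^ k := by positivity
      refine (measure_mono fun z hz => hz.2).trans ((measure_exists_block_le meth hlam
        (by positivity) a (hpos.trans_le (hD k hk))).trans (ENNReal.ofReal_le_ofReal ?_))
      calc _ ≤ 2 ^ 23 * momentBound / (A * ρ ^ k) := by gcongr; exact hD k hk
        _ = _ := by
          rw [inv_pow]
          field_simp
    · have : S k = ∅ := eq_empty_of_forall_notMem fun z hz => hk hz.1
      simp [this]
  have hsub : {z | ∃ c ∈ Icc lo hi,
      1 / 4 * D meth lam a c < |R1 meth lam a z c| + |R2 meth lam z c| ∨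
      1 / 4 * D meth lam a c < |R3 lam a z c| + |R4 lam z c|} ⊆ ⋃ k, S k := by
    rintro z ⟨c, hc, hz⟩
    obtain ⟨k, hk1, hk2⟩ := exists_nat_pow_near (x := c / lo) (y := (5 / 4 : ℝ))
      ((one_le_div hlo).2 hc.1) (by norm_num)
    rw [le_div_iff₀ hlo, mul_comm] at hk1
    rw [div_lt_iff₀ hlo, pow_succ] at hk2
    have hpos : 0 < lo * (5 / 4) ^ k := by positivity
    refine mem_iUnion.2 ⟨k, hk1.trans hc.2, c / (lo * (5 / 4) ^ k) - 1, ⟨?_, ?_⟩, ?_⟩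
    · rw [sub_nonneg, one_le_div hpos]
      exact hk1
    · rw [sub_le_iff_le_add, div_le_iff₀ hpos]
      linarith
    · have : (1 + (c / (lo * (5 / 4) ^ k) - 1)) * (lo * (5 / 4) ^ k) = c := by
        rw [add_sub_cancel, div_mul_cancel₀ _ hpos.ne']
      rwa [this]
  have hs : HasSum (fun k : ℕ => 2 ^ 23 * momentBound / A * ρ⁻¹ ^ k)
      (2 ^ 23 * momentBound / A * (1 - ρ⁻¹)⁻¹) :=
    (hasSum_geometric_of_lt_one (by positivity) (inv_lt_one_of_one_lt₀ hρ)).mul_left _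
  refine (measure_mono hsub).trans ((measure_iUnion_le S).trans ((ENNReal.tsum_le_tsum hS).trans ?_))
  rw [← ENNReal.ofReal_tsum_of_nonneg (fun k => by positivity) hs.summable, hs.tsum_eq]

/-- Chebyshev's inequality for `Nvar`. -/
lemma measure_Nvar_lt_le (hlam : ∀ j, 0 ≤ lam j) (hc : 0 ≤ c) (hs : 0 < sSq lam c) :
    (Measure.pi fun _ : ι => gaussianReal 0 1) {z | Nvar lam z c < sSq lam c / 2} ≤
      ENNReal.ofReal (4 * momentBound / sSq lam c) := by
  have h := measure_le_abs_sum_le memLp_sq_sub_one integral_sq_sub_one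
    (fun j => c * lam j / (1 + c * lam j)) (half_pos hs)
  refine (measure_mono fun z hz => ?_).trans (h.trans (ENNReal.ofReal_le_ofReal ?_))
  · have e : ∑ j, (z j ^ 2 - 1) * (c * lam j / (1 + c * lam j)) = Nvar lam z c - sSq lam c := by
      rw [Nvar, sSq, ← Finset.sum_sub_distrib]
      exact Finset.sum_congr rfl fun j _ => by ring
    have hz' : Nvar lam z c < sSq lam c / 2 := hz
    rw [mem_ofPred_eq, e, le_abs]
    right
    linarith
  · have h1 : ∑ j, (c * lam j / (1 + c * lam j)) ^ 2 ≤ sSq lam c := by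
      simp only [div_pow]
      exact D2_risk_le_sSq hlam hc
    calc _ ≤ momentBound * sSq lam c / (sSq lam c / 2) ^ 2 := by
          gcongr
          · exact momentBound_nonneg
          · exact integral_sq_sub_one_sq_le_momentBound
      _ = _ := by
          field_simp
          norm_num

end Block

/-! ### Lattice point counts for the three eigenvalue patterns. -/

section Counting

lemma sum_range_inv_sqrt_le (n : ℕ) : ∑ j ∈ Finset.range n, (√((j : ℝ) + 1))⁻¹ ≤ 2 * √(n : ℝ) := by
  induction n with
  | zero => simp
  | succ n ih =>
    rw [Finset.sum_range_succ]
    push_cast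
    have h1 : 0 < √((n : ℝ) + 1) := Real.sqrt_pos.2 (by positivity)
    have h2 := Real.sqrt_nonneg (n : ℝ)
    have h3 := Real.sq_sqrt (show (0 : ℝ) ≤ n by positivity)
    have h4 := Real.sq_sqrt (show (0 : ℝ) ≤ (n : ℝ) + 1 by positivity)
    have h5 : (√((n : ℝ) + 1))⁻¹ ≤ 2 * √((n : ℝ) + 1) - 2 * √(n : ℝ) := by
      rw [inv_le_iff_one_le_mul₀ h1]
      nlinarith [sq_nonneg (√((n : ℝ) + 1) - √(n : ℝ))]
    linarith

lemma sum_fin_ite_eq (k : ℕ) {y : ℝ} (hy : 0 ≤ y) (g : ℕ → ℝ) :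
    ∑ j : Fin k, (if ((j : ℕ) : ℝ) + 1 ≤ y then g j else 0) =
      ∑ j ∈ Finset.range (min k ⌊y⌋₊), g j := by
  rw [Fin.sum_univ_eq_sum_range (fun j : ℕ => if (j : ℝ) + 1 ≤ y then g j else 0) k,
    ← Finset.sum_filter]
  congr 1
  ext j
  have : (j : ℝ) + 1 ≤ y ↔ j < ⌊y⌋₊ := by
    rw [← Nat.succ_le_iff, Nat.le_floor_iff hy]
    push_cast
    rfl
  simp [this]

lemma half_le_sum_fin_ite {k : ℕ} {y : ℝ} (hy : 1 ≤ y) (hk : y ≤ k) :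
    y / 2 ≤ ∑ j : Fin k, (if ((j : ℕ) : ℝ) + 1 ≤ y then (1 : ℝ) else 0) := by
  have hy0 : 0 ≤ y := by linarith
  rw [sum_fin_ite_eq k hy0 fun _ => 1, min_eq_right (Nat.floor_le_of_le hk)]
  have h1 := Nat.lt_floor_add_one y
  have h2 : (1 : ℝ) ≤ (⌊y⌋₊ : ℝ) := by exact_mod_cast (Nat.one_le_floor_iff y).2 hy
  simp
  linarith

lemma sum_fin_inv_sqrt_le (k : ℕ) {y : ℝ} (hy : 0 ≤ y) :
    ∑ j : Fin k, (if ((j : ℕ) : ℝ) + 1 ≤ y then (√(((j : ℕ) : ℝ) + 1))⁻¹ else 0) ≤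
      2 * √(min (k : ℝ) y) := by
  rw [sum_fin_ite_eq k hy fun j => (√((j : ℝ) + 1))⁻¹]
  refine (sum_range_inv_sqrt_le _).trans ?_
  gcongr
  rw [Nat.cast_min]
  exact min_le_min_left _ (Nat.floor_le hy)

/-- The number of indices `i` with `d i ≤ x` is at least of the order `x`, and the sum of
`√(x / d i)` over these indices is at most of the order of their number, for `x` between two and
the number of all indices. -/
def RegularGrowth {ι : Type*} [Fintype ι] (C : ℝ) (d : ι → ℝ) : Prop :=
  ∀ x : ℝ, 2 ≤ x → x ≤ Fintype.card ι →
    x ≤ C * ∑ i, (if d i ≤ x then (1 : ℝ) else 0) ∧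
    ∑ i, (if d i ≤ x then √(x / d i) else 0) ≤ C * ∑ i, (if d i ≤ x then (1 : ℝ) else 0)

lemma RegularGrowth.comp_equiv {ι κ : Type*} [Fintype ι] [Fintype κ] {C : ℝ} {d : κ → ℝ}
    (h : RegularGrowth C d) (e : ι ≃ κ) : RegularGrowth C fun i => d (e i) := by
  intro x hx hx'
  rw [Fintype.card_congr e] at hx'
  rw [e.sum_comp fun i => if d i ≤ x then (1 : ℝ) else 0,
    e.sum_comp fun i => if d i ≤ x then √(x / d i) else 0]
  exact h x hx hx'

lemma RegularGrowth.mono {ι : Type*} [Fintype ι] {C C' : ℝ} {d : ι → ℝ}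
    (h : RegularGrowth C d) (hC : C ≤ C') : RegularGrowth C' d := by
  intro x hx hx'
  have h0 : 0 ≤ ∑ i, (if d i ≤ x then (1 : ℝ) else 0) :=
    Finset.sum_nonneg fun i _ => by split_ifs <;> simp
  have := mul_le_mul_of_nonneg_right hC h0
  exact ⟨(h x hx hx').1.trans this, (h x hx hx').2.trans this⟩

lemma sqrt_div_eq {x t : ℝ} (hx : 0 ≤ x) : √(x / t) = √x * (√t)⁻¹ := by
  rw [Real.sqrt_div hx, div_eq_mul_inv]

lemma regularGrowth_linear (N : ℕ) : RegularGrowth 4 fun j : Fin N => ((j : ℕ) : ℝ) + 1 := by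
  intro x hx hxN
  rw [Fintype.card_fin] at hxN
  have hx0 : 0 ≤ x := by linarith
  have h1 := half_le_sum_fin_ite (by linarith) hxN
  refine ⟨by linarith, ?_⟩
  have h2 := sum_fin_inv_sqrt_le N hx0
  rw [min_eq_right hxN] at h2
  calc _ = √x * ∑ j : Fin N, (if ((j : ℕ) : ℝ) + 1 ≤ x then (√(((j : ℕ) : ℝ) + 1))⁻¹ else 0) := by
        rw [Finset.mul_sum]
        refine Finset.sum_congr rfl fun j _ => ?_
        split_ifs
        · exact sqrt_div_eq hx0
        · simp
    _ ≤ √x * (2 * √x) := by gcongr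
    _ = 2 * x := by linarith [Real.mul_self_sqrt hx0]
    _ ≤ _ := by linarith

lemma sq_le_sum_prod_ite {k : ℕ} {d : Fin k × Fin k → ℝ} {x y : ℝ} (hy : 1 ≤ y) (hk : y ≤ k)
    (hd : ∀ i j : Fin k, ((i : ℕ) : ℝ) + 1 ≤ y → ((j : ℕ) : ℝ) + 1 ≤ y → d (i, j) ≤ x) :
    y ^ 2 / 4 ≤ ∑ i, (if d i ≤ x then (1 : ℝ) else 0) := by
  have h := half_le_sum_fin_ite hy hk
  calc y ^ 2 / 4 = y / 2 * (y / 2) := by ring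
    _ ≤ (∑ j : Fin k, (if ((j : ℕ) : ℝ) + 1 ≤ y then (1 : ℝ) else 0)) *
        ∑ j : Fin k, (if ((j : ℕ) : ℝ) + 1 ≤ y then (1 : ℝ) else 0) := by gcongr
    _ ≤ _ := by
      rw [Finset.sum_mul_sum, Fintype.sum_prod_type]
      refine Finset.sum_le_sum fun i _ => Finset.sum_le_sum fun j _ => ?_
      by_cases h1 : ((i : ℕ) : ℝ) + 1 ≤ y <;> by_cases h2 : ((j : ℕ) : ℝ) + 1 ≤ y
      · simp [h1, h2, hd i j h1 h2]
      all_goals simp only [h1, h2, if_true, if_false, mul_zero, zero_mul]; split_ifs <;> simp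

lemma sqrt_le_of_le_mul_self {k : ℕ} {x : ℝ} (hx : x ≤ (k : ℝ) * k) : √x ≤ k :=
  Real.sqrt_le_iff.2 ⟨k.cast_nonneg, by rwa [pow_two]⟩

/-- The box of side `√(x/2)` gives the count, and `x ≥ 2` makes it nonempty. For the sum, `i² + j² ≥
i j` reduces to a product of two one-dimensional sums, bounded by `4 x`. -/
lemma regularGrowth_sum_sq (k : ℕ) :
    RegularGrowth 32 fun i : Fin k × Fin k =>
      (((i.1 : ℕ) : ℝ) + 1) ^ 2 + (((i.2 : ℕ) : ℝ) + 1) ^ 2 := by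
  intro x hx hxk
  have hx0 : 0 ≤ x := by linarith
  rw [Fintype.card_prod, Fintype.card_fin, Nat.cast_mul] at hxk
  have hsk := sqrt_le_of_le_mul_self hxk
  have h1 : 1 ≤ √(x / 2) := Real.one_le_sqrt.2 (by linarith)
  have h2 : √(x / 2) ≤ k := (Real.sqrt_le_sqrt (by linarith)).trans hsk
  have hsq : √(x / 2) ^ 2 = x / 2 := Real.sq_sqrt (by linarith)
  have h3 := sq_le_sum_prod_ite (x := x) (d := fun i : Fin k × Fin k =>
      (((i.1 : ℕ) : ℝ) + 1) ^ 2 + (((i.2 : ℕ) : ℝ) + 1) ^ 2) h1 h2 fun i j hi hj => by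
    have := pow_le_pow_left₀ (by positivity) hi 2
    have := pow_le_pow_left₀ (by positivity) hj 2
    linarith
  rw [hsq] at h3
  refine ⟨by linarith, ?_⟩
  set s := ∑ j : Fin k, (if ((j : ℕ) : ℝ) + 1 ≤ √x then (√(((j : ℕ) : ℝ) + 1))⁻¹ else 0) with hs
  have hs0 : 0 ≤ s := Finset.sum_nonneg fun j _ => by split_ifs <;> positivity
  have h4 : s ≤ 2 * √(√x) := by
    have := sum_fin_inv_sqrt_le k (Real.sqrt_nonneg x)
    rwa [min_eq_right hsk] at this
  have h5 : s * s ≤ 4 * √x := by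
    have := mul_le_mul h4 h4 hs0 (by positivity)
    have := Real.mul_self_sqrt (Real.sqrt_nonneg x)
    linarith
  have h6 : ∑ i : Fin k × Fin k,
      (if (((i.1 : ℕ) : ℝ) + 1) ^ 2 + (((i.2 : ℕ) : ℝ) + 1) ^ 2 ≤ x then
        √(x / ((((i.1 : ℕ) : ℝ) + 1) ^ 2 + (((i.2 : ℕ) : ℝ) + 1) ^ 2)) else 0) ≤
      √x * (s * s) := by
    rw [hs, Finset.sum_mul_sum, Fintype.sum_prod_type, Finset.mul_sum]
    refine Finset.sum_le_sum fun i _ => ?_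
    rw [Finset.mul_sum]
    refine Finset.sum_le_sum fun j _ => ?_
    have hi : (0 : ℝ) < ((i : ℕ) : ℝ) + 1 := by positivity
    have hj : (0 : ℝ) < ((j : ℕ) : ℝ) + 1 := by positivity
    dsimp only
    split_ifs with e1 e2 e3 e3
    · rw [← mul_inv, ← Real.sqrt_mul hi.le, ← sqrt_div_eq hx0]
      refine Real.sqrt_le_sqrt (div_le_div_of_nonneg_left hx0 (by positivity) ?_)
      nlinarith [sq_nonneg ((((i : ℕ) : ℝ) + 1) - (((j : ℕ) : ℝ) + 1)), mul_pos hi hj]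
    · exact absurd (Real.le_sqrt_of_sq_le (by nlinarith)) e3
    · exact absurd (Real.le_sqrt_of_sq_le (by nlinarith)) e2
    · exact absurd (Real.le_sqrt_of_sq_le (by nlinarith)) e2
    all_goals positivity
  have h7 : √x * (s * s) ≤ 4 * x := by
    have := mul_le_mul_of_nonneg_left h5 (Real.sqrt_nonneg x)
    have := Real.mul_self_sqrt hx0
    linarith
  linarith

/-- The count can exceed `x` by a logarithmic factor, so the sum is compared with the count row by
row. Rows of length `y = x / i ≤ k` are one-dimensional; rows cut off at `k` have `i ≤ x / k` and
contribute at most `4 x` together. -/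
lemma regularGrowth_mul (k : ℕ) :
    RegularGrowth 32 fun i : Fin k × Fin k => (((i.1 : ℕ) : ℝ) + 1) * (((i.2 : ℕ) : ℝ) + 1) := by
  intro x hx hxk
  have hx0 : 0 ≤ x := by linarith
  rw [Fintype.card_prod, Fintype.card_fin, Nat.cast_mul] at hxk
  have hsk := sqrt_le_of_le_mul_self hxk
  have hk : (0 : ℝ) < k := (Real.sqrt_pos.2 (by linarith)).trans_le hsk
  have h3 := sq_le_sum_prod_ite (x := x) (d := fun i : Fin k × Fin k =>
      (((i.1 : ℕ) : ℝ) + 1) * (((i.2 : ℕ) : ℝ) + 1)) (Real.one_le_sqrt.2 (by linarith)) hsk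
      fun i j hi hj => by
    have := mul_le_mul hi hj (by positivity) (Real.sqrt_nonneg x)
    rwa [Real.mul_self_sqrt hx0] at this
  rw [Real.sq_sqrt hx0] at h3
  refine ⟨by linarith, ?_⟩
  have hrow : ∀ i : Fin k, ∑ j : Fin k,
      (if (((i : ℕ) : ℝ) + 1) * (((j : ℕ) : ℝ) + 1) ≤ x then
        √(x / ((((i : ℕ) : ℝ) + 1) * (((j : ℕ) : ℝ) + 1))) else 0) ≤
      4 * ∑ j : Fin k, (if (((i : ℕ) : ℝ) + 1) * (((j : ℕ) : ℝ) + 1) ≤ x then (1 : ℝ) else 0) +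
      2 * √(x * k) * (if ((i : ℕ) : ℝ) + 1 ≤ x / k then (√(((i : ℕ) : ℝ) + 1))⁻¹ else 0) := by
    intro i
    have hi : (0 : ℝ) < ((i : ℕ) : ℝ) + 1 := by positivity
    set y := x / (((i : ℕ) : ℝ) + 1) with hy
    have hy0 : 0 ≤ y := by positivity
    have hiff : ∀ j : Fin k, (((i : ℕ) : ℝ) + 1) * (((j : ℕ) : ℝ) + 1) ≤ x ↔
        ((j : ℕ) : ℝ) + 1 ≤ y := fun j => by
      rw [hy, le_div_iff₀ hi, mul_comm]
    have hfac : ∀ j : Fin k, √(x / ((((i : ℕ) : ℝ) + 1) * (((j : ℕ) : ℝ) + 1))) =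
        √y * (√(((j : ℕ) : ℝ) + 1))⁻¹ := fun j => by
      rw [← div_div, sqrt_div_eq hy0]
    simp only [hiff, hfac]
    have e1 : ∑ j : Fin k, (if ((j : ℕ) : ℝ) + 1 ≤ y then √y * (√(((j : ℕ) : ℝ) + 1))⁻¹ else 0) ≤
        √y * (2 * √(min (k : ℝ) y)) := by
      refine le_trans (le_of_eq ?_) (mul_le_mul_of_nonneg_left (sum_fin_inv_sqrt_le k hy0)
        (Real.sqrt_nonneg y))
      rw [Finset.mul_sum]
      exact Finset.sum_congr rfl fun j _ => by split_ifs <;> simp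
    have e2 : 0 ≤ ∑ j : Fin k, (if ((j : ℕ) : ℝ) + 1 ≤ y then (1 : ℝ) else 0) :=
      Finset.sum_nonneg fun j _ => by split_ifs <;> simp
    have e3 : 0 ≤ 2 * √(x * k) *
        (if ((i : ℕ) : ℝ) + 1 ≤ x / k then (√(((i : ℕ) : ℝ) + 1))⁻¹ else 0) := by
      split_ifs <;> positivity
    rcases lt_or_ge y 1 with hy1 | hy1
    · have : ∑ j : Fin k, (if ((j : ℕ) : ℝ) + 1 ≤ y then √y * (√(((j : ℕ) : ℝ) + 1))⁻¹ else 0)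
          = 0 := Finset.sum_eq_zero fun j _ => if_neg fun h => by
        have : (0 : ℝ) ≤ ((j : ℕ) : ℝ) := by positivity
        linarith
      linarith
    · rcases le_or_gt y k with hyk | hyk
      · have := half_le_sum_fin_ite hy1 hyk
        rw [min_eq_right hyk] at e1
        have := Real.mul_self_sqrt hy0
        linarith
      · rw [min_eq_left hyk.le] at e1
        have hik : ((i : ℕ) : ℝ) + 1 ≤ x / k := by
          rw [hy, lt_div_iff₀ hi] at hyk
          rw [le_div_iff₀ hk]
          linarith
        rw [if_pos hik]
        have : √y * (2 * √(k : ℝ)) = 2 * √(x * k) * (√(((i : ℕ) : ℝ) + 1))⁻¹ := by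
          rw [hy, sqrt_div_eq hx0, Real.sqrt_mul hx0]
          ring
        linarith
  have hxk' : 0 ≤ x / k := by positivity
  have hsum := Finset.sum_le_sum fun i (_ : i ∈ Finset.univ) => hrow i
  rw [Finset.sum_add_distrib, ← Finset.mul_sum, ← Finset.mul_sum] at hsum
  have h5 := mul_le_mul_of_nonneg_left ((sum_fin_inv_sqrt_le k hxk').trans
    (mul_le_mul_of_nonneg_left (Real.sqrt_le_sqrt (min_le_right _ _)) zero_le_two))
    (show 0 ≤ 2 * √(x * k) by positivity)
  have h6 : 2 * √(x * k) * (2 * √(x / k)) = 4 * x := by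
    have : √(x * k) * √(x / k) = x := by
      rw [← Real.sqrt_mul (by positivity), show x * k * (x / k) = x * x by field_simp,
        Real.sqrt_mul_self hx0]
    linarith
  rw [Fintype.sum_prod_type, Fintype.sum_prod_type]
  rw [Fintype.sum_prod_type] at h3
  linarith

end Counting

/-! ### Variance bounds from eigenvalue decay. -/

section Eigenvalues

/-- The eigenvalues are of the order `N / d ^ m`, for `N` numbers `d i` of regular growth. -/
def GrowthEigenvalues {ι : Type*} [Fintype ι] (m δ₁ δ₂ : ℝ) (lam : ι → ℝ) : Prop :=
  ∃ d : ι → ℝ, (∀ i, 0 < d i) ∧ RegularGrowth 32 d ∧ ∀ i,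
    δ₁ * ((Fintype.card ι : ℝ) / d i ^ m) ≤ lam i ∧ lam i ≤ δ₂ * ((Fintype.card ι : ℝ) / d i ^ m)

section Fixed

variable {ι : Type*} [Fintype ι] {m δ₁ δ₂ X c : ℝ} {lam : ι → ℝ} {d : ι → ℝ}

/-- With `X` the effective dimension, `c λ` is of the order `(X / d) ^ m`: indices with `d ≤ X`
carry the variance. -/
lemma scale_mul_div_rpow (hd : ∀ i, 0 < d i) (hX : 0 ≤ X)
    (hXm : X ^ m = c * Fintype.card ι) (i : ι) :
    c * (Fintype.card ι / d i ^ m) = (X / d i) ^ m := by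
  rw [Real.div_rpow hX (hd i).le, hXm, mul_div_assoc]

lemma le_scale_mul (hm : 0 ≤ m) (hδ : 0 < δ₁) (hd : ∀ i, 0 < d i) (hc : 0 ≤ c) (hX : 0 ≤ X)
    (hXm : X ^ m = c * Fintype.card ι)
    (hl : ∀ i, δ₁ * ((Fintype.card ι : ℝ) / d i ^ m) ≤ lam i) {i : ι} (hi : d i ≤ X) :
    δ₁ ≤ c * lam i := by
  have h1 : 1 ≤ (X / d i) ^ m := Real.one_le_rpow ((one_le_div (hd i)).2 hi) hm
  rw [← scale_mul_div_rpow hd hX hXm] at h1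
  nlinarith [mul_le_mul_of_nonneg_left (hl i) hc]

lemma count_le_D2 (hm : 0 ≤ m) (hδ : 0 < δ₁) (hd : ∀ i, 0 < d i) (hc : 0 ≤ c) (hX : 0 ≤ X)
    (hXm : X ^ m = c * Fintype.card ι)
    (hl : ∀ i, δ₁ * ((Fintype.card ι : ℝ) / d i ^ m) ≤ lam i) :
    (δ₁ / (1 + δ₁)) ^ 2 * ∑ i, (if d i ≤ X then (1 : ℝ) else 0) ≤ D2 .risk lam c := by
  rw [Finset.mul_sum]
  refine Finset.sum_le_sum fun i _ => ?_
  rw [← div_pow]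
  split_ifs with h
  · rw [mul_one]
    exact pow_le_pow_left₀ (by positivity)
      (div_one_add_mono hδ.le (le_scale_mul hm hδ hd hc hX hXm hl h)) 2
  · rw [mul_zero]
    positivity

lemma count_le_sSq (hm : 0 ≤ m) (hδ : 0 < δ₁) (hd : ∀ i, 0 < d i) (hc : 0 ≤ c) (hX : 0 ≤ X)
    (hlam : ∀ i, 0 ≤ lam i) (hXm : X ^ m = c * Fintype.card ι)
    (hl : ∀ i, δ₁ * ((Fintype.card ι : ℝ) / d i ^ m) ≤ lam i) :
    δ₁ / (1 + δ₁) * ∑ i, (if d i ≤ X then (1 : ℝ) else 0) ≤ sSq lam c := by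
  rw [Finset.mul_sum]
  refine Finset.sum_le_sum fun i _ => ?_
  split_ifs with h
  · rw [mul_one]
    exact div_one_add_mono hδ.le (le_scale_mul hm hδ hd hc hX hXm hl h)
  · rw [mul_zero]
    exact (ratio_mem_Icc hlam hc i).1

/-- The penalty grows only like `m log s`, and `log s ≤ 2 √s`; this is the origin of the square
roots in `RegularGrowth`. -/
lemma logPenalty_mul_rpow_le {δ s m y : ℝ} (hδ : 0 ≤ δ) (hm : 0 ≤ m) (hs : 1 ≤ s) (hy : 0 ≤ y)
    (hys : y ≤ δ * s ^ m) : logPenalty y ≤ Real.log (1 + δ) + 2 * m * √s := by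
  have hs0 : 0 < s := one_pos.trans_le hs
  have h1 : 1 ≤ s ^ m := Real.one_le_rpow hs hm
  have h2 : logPenalty y ≤ Real.log (1 + y) :=
    sub_le_self _ (div_nonneg hy (by linarith))
  have h3 : Real.log (1 + y) ≤ Real.log ((1 + δ) * s ^ m) :=
    Real.log_le_log (by linarith) (by nlinarith)
  rw [Real.log_mul (by linarith) (by linarith), Real.log_rpow hs0] at h3
  have h4 : Real.log s ≤ 2 * √s := by
    have h5 := Real.log_sqrt hs0.le
    have h6 := Real.log_le_sub_one_of_pos (Real.sqrt_pos.2 hs0)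
    linarith
  nlinarith [mul_le_mul_of_nonneg_left h4 hm]

lemma D2_likelihood_le_sSq (hm : 0 ≤ m) (hδ : 0 < δ₁) (hδ₂ : 0 ≤ δ₂) (hd : ∀ i, 0 < d i)
    (hc : 0 ≤ c) (hX : 2 ≤ X) (hXc : X ≤ Fintype.card ι) (hlam : ∀ i, 0 ≤ lam i)
    (hXm : X ^ m = c * Fintype.card ι) (hg : RegularGrowth 32 d)
    (hl : ∀ i, δ₁ * ((Fintype.card ι : ℝ) / d i ^ m) ≤ lam i)
    (hu : ∀ i, lam i ≤ δ₂ * ((Fintype.card ι : ℝ) / d i ^ m)) :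
    D2 .likelihood lam c ≤
      ((Real.log (1 + δ₂) + 64 * m) * ((1 + δ₁) / δ₁) + δ₂) * sSq lam c := by
  have hX0 : 0 ≤ X := by linarith
  have h1 : D2 .likelihood lam c ≤ ∑ i, ((Real.log (1 + δ₂) * (if d i ≤ X then (1 : ℝ) else 0) +
      2 * m * (if d i ≤ X then √(X / d i) else 0)) + δ₂ * (c * lam i / (1 + c * lam i))) := by
    rw [D2_likelihood_eq]
    refine Finset.sum_le_sum fun i _ => ?_
    have hx := mul_nonneg hc (hlam i)
    have hp := mul_nonneg hδ₂ (ratio_mem_Icc hlam hc i).1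
    have hle : c * lam i ≤ δ₂ * (X / d i) ^ m := by
      rw [← scale_mul_div_rpow hd hX0 hXm]
      linarith [mul_le_mul_of_nonneg_left (hu i) hc]
    -- For `d ≤ X` the logarithm is controlled by regular growth; for `d > X`, `c λ ≤ δ₂` and the
    -- penalty is at most `δ₂` times the summand of `s²`.
    split_ifs with h
    · have := logPenalty_mul_rpow_le hδ₂ hm ((one_le_div (hd i)).2 h) hx hle
      linarith
    · have h2 : (X / d i) ^ m ≤ 1 :=
        Real.rpow_le_one (by have := hd i; positivity) ((div_le_one (hd i)).2 (not_le.1 h).le) hm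
      have := logPenalty_le hx (show c * lam i ≤ δ₂ by nlinarith)
      linarith
  rw [Finset.sum_add_distrib, Finset.sum_add_distrib, ← Finset.mul_sum, ← Finset.mul_sum,
    ← Finset.mul_sum] at h1
  have h2 := (hg X hX hXc).2
  have h3 := count_le_sSq hm hδ hd hc hX0 hlam hXm hl
  set n := ∑ i, (if d i ≤ X then (1 : ℝ) else 0)
  have h4 : n ≤ (1 + δ₁) / δ₁ * sSq lam c := by
    rw [div_mul_eq_mul_div, le_div_iff₀ hδ]
    rw [div_mul_eq_mul_div, div_le_iff₀ (by linarith)] at h3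
    linarith
  have h5 : 0 ≤ Real.log (1 + δ₂) := Real.log_nonneg (by linarith)
  have h6 := mul_le_mul_of_nonneg_left h2 (show 0 ≤ 2 * m by linarith)
  have h7 := mul_le_mul_of_nonneg_left h4 (show 0 ≤ Real.log (1 + δ₂) + 64 * m by linarith)
  have h8 : ∑ i, c * lam i / (1 + c * lam i) = sSq lam c := rfl
  rw [h8] at h1
  linarith

end Fixed

section Scales

variable {m c : ℝ} {N : ℕ}

/-- The effective dimension `(c N) ^ (1 / m)`, for `c` in the range of scales. -/
lemma effectiveDim_spec (hm : 1 ≤ m) (hN : 1 < N) (hc : c ∈ scaleInterval m N) :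
    ((c * N) ^ m⁻¹) ^ m = c * N ∧ (c * N) ^ m⁻¹ ≤ N ∧
      Real.log N ^ m⁻¹ ≤ (c * N) ^ m⁻¹ := by
  have hN0 : (0 : ℝ) < N := by positivity
  have hm0 : 0 < m := by linarith
  have hlog : 0 ≤ Real.log N := Real.log_natCast_nonneg N
  have h1 : Real.log N ≤ c * N := by
    rw [← div_le_iff₀ hN0]
    exact hc.1
  have h2 : c * N ≤ (N : ℝ) ^ m := by
    have := mul_le_mul_of_nonneg_right hc.2 hN0.le
    rwa [← Real.rpow_add_one hN0.ne', sub_add_cancel] at this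
  refine ⟨Real.rpow_inv_rpow (hlog.trans h1) hm0.ne', ?_,
    Real.rpow_le_rpow hlog h1 (inv_nonneg.2 hm0.le)⟩
  calc (c * N) ^ m⁻¹ ≤ ((N : ℝ) ^ m) ^ m⁻¹ :=
        Real.rpow_le_rpow (hlog.trans h1) h2 (inv_nonneg.2 hm0.le)
    _ = N := Real.rpow_rpow_inv hN0.le hm0.ne'

lemma scaleInterval_nonneg (hc : c ∈ scaleInterval m N) : 0 ≤ c :=
  (div_nonneg (Real.log_natCast_nonneg N) N.cast_nonneg).trans hc.1

end Scales

section Asymptotic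

variable {ι : ℕ → Type*} [∀ n, Fintype (ι n)] {m δ₁ δ₂ : ℝ} {lam : ∀ n, ι n → ℝ}

lemma tendsto_log_card_rpow (hm : 1 ≤ m) (hN : Tendsto (fun n => Fintype.card (ι n)) atTop atTop) :
    Tendsto (fun n => Real.log (Fintype.card (ι n)) ^ m⁻¹) atTop atTop :=
  (tendsto_rpow_atTop (by positivity)).comp
    (Real.tendsto_log_atTop.comp (tendsto_natCast_atTop_atTop.comp hN))

lemma eventually_scale_bounds (meth : EBMethod) (hm : 1 ≤ m)
    (hN : Tendsto (fun n => Fintype.card (ι n)) atTop atTop) (hlam : ∀ n j, 0 ≤ lam n j)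
    (hδ : 0 < δ₁) (hδ₂ : 0 ≤ δ₂)
    (hg : ∀ᶠ n in atTop, GrowthEigenvalues m δ₁ δ₂ (lam n)) :
    ∃ κ B : ℝ, 0 < κ ∧ 0 < B ∧ ∀ᶠ n in atTop, ∀ c ∈ scaleInterval m (Fintype.card (ι n)),
      κ * (c * Fintype.card (ι n)) ^ m⁻¹ ≤ D2 .risk (lam n) c ∧
      D2 meth (lam n) c ≤ B * sSq (lam n) c := by
  have hm0 : 0 ≤ m := by linarith
  have hlog : 0 ≤ Real.log (1 + δ₂) := Real.log_nonneg (by linarith)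
  refine ⟨(δ₁ / (1 + δ₁)) ^ 2 / 32,
    (Real.log (1 + δ₂) + 64 * m) * ((1 + δ₁) / δ₁) + δ₂ + 1, by positivity, by positivity, ?_⟩
  filter_upwards [hg, hN.eventually_gt_atTop 1,
    (tendsto_log_card_rpow hm hN).eventually_ge_atTop 2] with n ⟨d, hd, hreg, hb⟩ hn hlog2 c hc
  obtain ⟨h1, h2, h3⟩ := effectiveDim_spec hm hn hc
  have hX := hlog2.trans h3
  have hX0 : 0 ≤ (c * Fintype.card (ι n)) ^ m⁻¹ := by linarith
  have hc0 := scaleInterval_nonneg hc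
  constructor
  · refine le_trans ?_ (count_le_D2 hm0 hδ hd hc0 hX0 h1 fun i => (hb i).1)
    rw [div_mul_eq_mul_div, mul_div_assoc]
    refine mul_le_mul_of_nonneg_left ?_ (sq_nonneg _)
    linarith [(hreg _ hX h2).1]
  · have hs := sSq_nonneg (hlam n) hc0
    cases meth with
    | risk =>
      have h4 := D2_risk_le_sSq (hlam n) hc0
      have h5 : 0 ≤ ((Real.log (1 + δ₂) + 64 * m) * ((1 + δ₁) / δ₁) + δ₂) * sSq (lam n) c := by
        positivity
      linarith
    | likelihood =>
      have h4 := D2_likelihood_le_sSq hm0 hδ hδ₂ hd hc0 hX h2 (hlam n) h1 hreg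
        (fun i => (hb i).1) fun i => (hb i).2
      linarith

lemma tendsto_measure_exists_scale (meth : EBMethod) (hm : 1 ≤ m)
    (hN : Tendsto (fun n => Fintype.card (ι n)) atTop atTop) (hlam : ∀ n j, 0 ≤ lam n j)
    (a : ∀ n, ι n → ℝ) {κ : ℝ} (hκ : 0 < κ)
    (hD : ∀ᶠ n in atTop, ∀ c ∈ scaleInterval m (Fintype.card (ι n)),
      κ * (c * Fintype.card (ι n)) ^ m⁻¹ ≤ D2 .risk (lam n) c) :
    Tendsto (fun n => (Measure.pi fun _ : ι n => gaussianReal 0 1)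
      {z | ∃ c ∈ scaleInterval m (Fintype.card (ι n)),
        1 / 4 * D meth (lam n) (a n) c < |R1 meth (lam n) (a n) z c| + |R2 meth (lam n) z c| ∨
        1 / 4 * D meth (lam n) (a n) c < |R3 (lam n) (a n) z c| + |R4 (lam n) z c|})
      atTop (𝓝 0) := by
  have hm0 : 0 < m⁻¹ := by positivity
  have hρ : 1 < (5 / 4 : ℝ) ^ m⁻¹ := Real.one_lt_rpow (by norm_num) hm0
  have hlim : Tendsto (fun n => ENNReal.ofReal (2 ^ 23 * momentBound /
      (κ * Real.log (Fintype.card (ι n)) ^ m⁻¹) * (1 - ((5 / 4 : ℝ) ^ m⁻¹)⁻¹)⁻¹)) atTop (𝓝 0) := by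
    rw [← ENNReal.ofReal_zero]
    refine ENNReal.tendsto_ofReal ?_
    have h := ((tendsto_log_card_rpow hm hN).const_mul_atTop hκ).const_div_atTop
      (2 ^ 23 * momentBound)
    simpa using h.mul_const (1 - ((5 / 4 : ℝ) ^ m⁻¹)⁻¹)⁻¹
  refine tendsto_of_tendsto_of_tendsto_of_le_of_le' tendsto_const_nhds hlim
    (Eventually.of_forall fun n => zero_le) ?_
  filter_upwards [hD, hN.eventually_gt_atTop 1] with n hn hcard
  have hN0 : (0 : ℝ) < Fintype.card (ι n) := by positivity
  have hlog : 0 < Real.log (Fintype.card (ι n)) := Real.log_pos (by exact_mod_cast hcard)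
  -- At grid point `k` the effective dimension is `(log N) ^ (1/m) * ((5/4) ^ (1/m)) ^ k`; so `A = κ
  -- (log N) ^ (1/m)`, which diverges.
  refine measure_exists_interval_le meth (hlam n) (a n) (by positivity) (by positivity) hρ
    fun k hk => ?_
  have h54 : (1 : ℝ) ≤ (5 / 4) ^ k := one_le_pow₀ (by norm_num)
  refine le_trans (le_of_eq ?_) (hn _ ⟨le_mul_of_one_le_right (by positivity) h54, hk⟩)
  rw [mul_assoc, show Real.log (Fintype.card (ι n)) / (Fintype.card (ι n)) * (5 / 4) ^ k *
    (Fintype.card (ι n)) = Real.log (Fintype.card (ι n)) * (5 / 4 : ℝ) ^ k by field_simp,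
    Real.mul_rpow hlog.le (by positivity), ← Real.rpow_natCast, ← Real.rpow_natCast,
    ← Real.rpow_mul (by norm_num), ← Real.rpow_mul (by norm_num), mul_comm m⁻¹]

lemma eventually_measure_Nvar_lt_of_growth (hm : 1 ≤ m)
    (hN : Tendsto (fun n => Fintype.card (ι n)) atTop atTop) (hlam : ∀ n j, 0 ≤ lam n j)
    {κ : ℝ} (hκ : 0 < κ)
    (hD : ∀ᶠ n in atTop, ∀ c ∈ scaleInterval m (Fintype.card (ι n)),
      κ * (c * Fintype.card (ι n)) ^ m⁻¹ ≤ D2 .risk (lam n) c) {η : ℝ} (hη : 0 < η) :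
    ∀ᶠ n in atTop, ∀ c ∈ scaleInterval m (Fintype.card (ι n)), 0 < sSq (lam n) c ∧
      (Measure.pi fun _ : ι n => gaussianReal 0 1) {z | Nvar (lam n) z c < sSq (lam n) c / 2}
        < ENNReal.ofReal η := by
  have hpos : 0 ≤ 4 * momentBound / η := by
    have := momentBound_nonneg
    positivity
  filter_upwards [hD, hN.eventually_gt_atTop 1,
    ((tendsto_log_card_rpow hm hN).const_mul_atTop hκ).eventually_gt_atTop
      (4 * momentBound / η)] with n hn hcard hlog c hc
  have hc0 := scaleInterval_nonneg hc
  have h1 : 4 * momentBound / η < sSq (lam n) c := by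
    refine hlog.trans_le (le_trans ?_ ((hn c hc).trans (D2_risk_le_sSq (hlam n) hc0)))
    exact mul_le_mul_of_nonneg_left (effectiveDim_spec hm hcard hc).2.2 hκ.le
  have hs : 0 < sSq (lam n) c := hpos.trans_lt h1
  refine ⟨hs, (measure_Nvar_lt_le (hlam n) hc0 hs).trans_lt ?_⟩
  rw [ENNReal.ofReal_lt_ofReal_iff hη, div_lt_iff₀ hs]
  rw [div_lt_iff₀ hη] at h1
  linarith

lemma PolynomialEigenvalues.exists_growth (h : PolynomialEigenvalues m lam) :
    ∃ δ₁ δ₂ : ℝ, 0 < δ₁ ∧ 0 ≤ δ₂ ∧ ∀ᶠ n in atTop, GrowthEigenvalues m δ₁ δ₂ (lam n) := by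
  obtain ⟨δ₁, δ₂, h1, h2, h⟩ := h
  refine ⟨δ₁, δ₂, h1, h1.le.trans h2, h.mono fun n ⟨num, hn⟩ => ?_⟩
  exact ⟨fun i => ((num i : ℕ) : ℝ) + 1, fun i => by positivity,
    ((regularGrowth_linear _).mono (by norm_num)).comp_equiv num, hn⟩

lemma card_eq_sq {κ : Type*} [Fintype κ] {k : ℕ} (num : κ ≃ Fin k × Fin k) :
    (Fintype.card κ : ℝ) = (k : ℝ) ^ 2 := by
  rw [Fintype.card_congr num, Fintype.card_prod, Fintype.card_fin, Nat.cast_mul, pow_two]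

lemma ProductEigenvalues.exists_growth (h : ProductEigenvalues m lam) :
    ∃ δ₁ δ₂ : ℝ, 0 < δ₁ ∧ 0 ≤ δ₂ ∧ ∀ᶠ n in atTop, GrowthEigenvalues m δ₁ δ₂ (lam n) := by
  obtain ⟨δ₁, δ₂, h1, h2, h⟩ := h
  refine ⟨δ₁, δ₂, h1, h1.le.trans h2, h.mono fun n ⟨k, num, hn⟩ => ?_⟩
  refine ⟨fun i => ((((num i).1 : ℕ) : ℝ) + 1) * ((((num i).2 : ℕ) : ℝ) + 1),
    fun i => by positivity, (regularGrowth_mul k).comp_equiv num, fun i => ?_⟩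
  rw [card_eq_sq num, Real.mul_rpow (by positivity) (by positivity)]
  exact hn i

lemma SobolevEigenvalues.exists_growth (h : SobolevEigenvalues m lam) :
    ∃ δ₁ δ₂ : ℝ, 0 < δ₁ ∧ 0 ≤ δ₂ ∧ ∀ᶠ n in atTop, GrowthEigenvalues m δ₁ δ₂ (lam n) := by
  obtain ⟨δ₁, δ₂, h1, h2, h⟩ := h
  refine ⟨δ₁, δ₂, h1, h1.le.trans h2, h.mono fun n ⟨k, num, hn⟩ => ?_⟩
  refine ⟨fun i => ((((num i).1 : ℕ) : ℝ) + 1) ^ 2 + ((((num i).2 : ℕ) : ℝ) + 1) ^ 2,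
    fun i => by positivity, (regularGrowth_sum_sq k).comp_equiv num, fun i => ?_⟩
  rw [card_eq_sq num]
  exact hn i

end Asymptotic

end Eigenvalues

end EmpiricalBayes

/-! ### Assembly of the theorem. -/

theorem mainTheorem5
    {𝒳 Ω Ω' : Type*} [MeasurableSpace Ω] [MeasurableSpace Ω']
    -- the unit scale prior: a mean zero Gaussian process on an arbitrary index set
    (P' : Measure Ω') [IsProbabilityMeasure P']
    (W : 𝒳 → Ω' → ℝ) (hW : IsGaussianProcess W P') (hW₀ : ∀ t, ∫ ω, W t ω ∂P' = 0)
    -- at stage `n`: the index set `ι n` of the design points, of size `N_n → ∞`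
    (ι : ℕ → Type*) [∀ n, Fintype (ι n)] [∀ n, DecidableEq (ι n)]
    (hN : Tendsto (fun n => Fintype.card (ι n)) atTop atTop)
    (x : ∀ n, ι n → 𝒳)
    -- orthonormal eigenbasis and eigenvalues of the prior covariance matrix
    (e : ∀ n, OrthonormalBasis (ι n) ℝ (EuclideanSpace ℝ (ι n))) (lam : ∀ n, ι n → ℝ)
    (he : ∀ n j, EmpiricalBayes.priorCov P' W (x n) *ᵥ (e n j).ofLp = lam n j • (e n j).ofLp)
    -- independent standard normal errors
    (P : Measure Ω) [IsProbabilityMeasure P] (ε : ∀ n, ι n → Ω → ℝ)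
    (hε : ∀ n i, HasLaw (ε n i) (gaussianReal 0 1) P) (hindep : ∀ n, iIndepFun (ε n) P)
    -- the true function, the range of scales and the method
    (f : 𝒳 → ℝ) (m : ℝ) (hm : 1 ≤ m) (meth : EmpiricalBayes.EBMethod)
    (I : ℕ → Set ℝ) (hI : ∀ n, I n = EmpiricalBayes.scaleInterval m (Fintype.card (ι n)))
    (a : ∀ n, ι n → ℝ) (ha : ∀ n, a n = EmpiricalBayes.coord (e n) (fun i => f (x n i)))
    (Z : ∀ n, Ω → ι n → ℝ)
    (hZ : ∀ n ω, Z n ω = EmpiricalBayes.coord (e n) (fun i => ε n i ω))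
    -- condition on the true function
    (hbias : EmpiricalBayes.GoodBias meth I lam a)
    (henergy : ∀ᶠ n in atTop,
      ∑ j, a n j ^ 2 ≤ sSup (EmpiricalBayes.D2 meth (lam n) '' I n))
    -- either the three general conditions, or one of the three eigenvalue conditions
    (hcond :
      (EmpiricalBayes.SupTendstoZeroInProb P I (fun n c ω =>
          (|EmpiricalBayes.R1 meth (lam n) (a n) (Z n ω) c|
            + |EmpiricalBayes.R2 meth (lam n) (Z n ω) c|)
            / EmpiricalBayes.D meth (lam n) (a n) c) ∧
        EmpiricalBayes.SupTendstoZeroInProb P I (fun n c ω =>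
          (|EmpiricalBayes.R3 (lam n) (a n) (Z n ω) c| + |EmpiricalBayes.R4 (lam n) (Z n ω) c|)
            / EmpiricalBayes.D meth (lam n) (a n) c) ∧
        EmpiricalBayes.SupTendstoZeroInProb P I (fun n c ω =>
          EmpiricalBayes.Nvar (lam n) (Z n ω) c / EmpiricalBayes.sSq (lam n) c - 1) ∧
        EmpiricalBayes.UniformAsymp I (fun n => EmpiricalBayes.D2 .risk (lam n))
          (fun n => EmpiricalBayes.D2 .likelihood (lam n)) ∧
        EmpiricalBayes.UniformAsymp I (fun n => EmpiricalBayes.D2 .likelihood (lam n))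
          (fun n => EmpiricalBayes.sSq (lam n))) ∨
      EmpiricalBayes.PolynomialEigenvalues m lam ∨
      EmpiricalBayes.ProductEigenvalues m lam ∨
      EmpiricalBayes.SobolevEigenvalues m lam) :
    ∃ M₀ : ℝ, ∀ M : ℝ, M₀ ≤ M → ∀ η ∈ Ioo (0 : ℝ) 1,
      ∀ chat : ℕ → Ω → ℝ,
        (∀ n ω, EmpiricalBayes.IsEBEstimate meth (EmpiricalBayes.priorCov P' W (x n)) (I n)
          (fun i => f (x n i) + ε n i ω) (chat n ω)) →
        Tendsto (fun n => P {ω | f ∈ EmpiricalBayes.credibleSet (x n)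
            (EmpiricalBayes.priorCov P' W (x n)) (chat n ω) η M
            (fun i => f (x n i) + ε n i ω)})
          atTop (𝓝 1) := by
  have hlam : ∀ n j, 0 ≤ lam n j := fun n =>
    EmpiricalBayes.eigenvalue_nonneg (fun t => (hW.hasGaussianLaw_eval t).memLp_two) (x n) (he n)
  have hlaw : ∀ n, HasLaw (Z n) (Measure.pi fun _ : ι n => gaussianReal 0 1) P := fun n => by
    rw [funext (hZ n)]
    exact EmpiricalBayes.hasLaw_coord (hε n) (hindep n) (e n)
  have hI0 : ∀ n, ∀ c ∈ I n, 0 ≤ c := fun n c hc =>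
    EmpiricalBayes.scaleInterval_nonneg (hI n ▸ hc)
  -- Both sets of assumptions lead to these facts, which are weaker than the general conditions: the
  -- remainders need only be below `D / 4`, and only the lower tail of `N(c)` matters, one scale at
  -- a time.
  suffices h : ∃ B : ℝ, 0 < B ∧
      (∀ᶠ n in atTop, ∀ c ∈ I n, 0 < EmpiricalBayes.sSq (lam n) c ∧
        EmpiricalBayes.D2 meth (lam n) c ≤ B * EmpiricalBayes.sSq (lam n) c) ∧
      Tendsto (fun n => P {ω | ∃ c ∈ I n, 1 / 4 * EmpiricalBayes.D meth (lam n) (a n) c <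
        |EmpiricalBayes.R1 meth (lam n) (a n) (Z n ω) c|
          + |EmpiricalBayes.R2 meth (lam n) (Z n ω) c|}) atTop (𝓝 0) ∧
      Tendsto (fun n => P {ω | ∃ c ∈ I n, 1 / 4 * EmpiricalBayes.D meth (lam n) (a n) c <
        |EmpiricalBayes.R3 (lam n) (a n) (Z n ω) c|
          + |EmpiricalBayes.R4 (lam n) (Z n ω) c|}) atTop (𝓝 0) ∧
      ∀ η ∈ Ioo (0 : ℝ) 1, ∀ᶠ n in atTop, ∀ c ∈ I n,
        (Measure.pi fun _ : ι n => gaussianReal 0 1)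
          {z | EmpiricalBayes.Nvar (lam n) z c < EmpiricalBayes.sSq (lam n) c / 2}
            < ENNReal.ofReal η by
    obtain ⟨B, hB, hs, hR12, hR34, hNv⟩ := h
    exact EmpiricalBayes.tendsto_coverage ι x _ e lam
      (fun n => EmpiricalBayes.eq_spectralMatrix (he n)) hlam P ε f meth I _ _ hI
      (fun n => div_nonneg (Real.log_natCast_nonneg _) (Nat.cast_nonneg _))
      a ha Z hZ hbias henergy hB hs hR12 hR34 hNv
  rcases hcond with ⟨h12, h34, hNs, hRL, hLs⟩ | hcond
  · have hs := EmpiricalBayes.eventually_sSq_pos hlam hI0 hNs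
    obtain ⟨B, hB, hBs⟩ := EmpiricalBayes.exists_D2_le_of_uniformAsymp meth hlam hI0 hLs
    have hD : ∀ᶠ n in atTop, ∀ c ∈ I n, ∀ _ : Ω, 0 < EmpiricalBayes.D meth (lam n) (a n) c := by
      filter_upwards [EmpiricalBayes.eventually_D2_pos meth hRL hLs hs] with n hn c hc _
      exact add_pos_of_nonneg_of_pos
        (EmpiricalBayes.D1_nonneg (hlam n) (hI0 n c hc) meth (a n)) (hn c hc)
    exact ⟨B, hB, (hs.and hBs).mono fun n hn c hc => ⟨hn.1 c hc, hn.2 c hc⟩,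
      h12.tendsto_exists_lt (fun n c ω => by positivity) hD (by norm_num),
      h34.tendsto_exists_lt (fun n c ω => by positivity) hD (by norm_num),
      fun η hη => EmpiricalBayes.eventually_measure_Nvar_lt hlaw hs hNs hη.1⟩
  · have hgrowth : ∃ δ₁ δ₂ : ℝ, 0 < δ₁ ∧ 0 ≤ δ₂ ∧
        ∀ᶠ n in atTop, EmpiricalBayes.GrowthEigenvalues m δ₁ δ₂ (lam n) := by
      rcases hcond with h | h | h
      · exact h.exists_growth
      · exact h.exists_growth
      · exact h.exists_growth
    obtain ⟨δ₁, δ₂, hδ₁, hδ₂, hg⟩ := hgrowth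
    obtain ⟨κ, B, hκ, hB, hκB⟩ :=
      EmpiricalBayes.eventually_scale_bounds meth hm hN hlam hδ₁ hδ₂ hg
    have hD := hκB.mono fun n hn c hc => (hn c hc).1
    have hlim := EmpiricalBayes.tendsto_measure_exists_scale meth hm hN hlam a hκ hD
    simp only [← hI] at hκB hD hlim
    have hNv := fun (η : ℝ) (hη : 0 < η) =>
      EmpiricalBayes.eventually_measure_Nvar_lt_of_growth hm hN hlam hκ
        (by simpa only [← hI] using hD) hη
    simp only [← hI] at hNv
    -- Holds for arbitrary sets, so the events quantified over uncountably many scales need not be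
    -- shown measurable.
    have hle : ∀ n, ∀ (s : Set Ω) (t : Set (ι n → ℝ)), (∀ ω ∈ s, Z n ω ∈ t) →
        P s ≤ (Measure.pi fun _ : ι n => gaussianReal 0 1) t := fun n s t hst => by
      rw [← (hlaw n).map_eq]
      exact (measure_mono hst).trans (Measure.le_map_apply (hlaw n).aemeasurable t)
    refine ⟨B, hB, ((hNv 1 one_pos).and hκB).mono fun n hn c hc =>
      ⟨(hn.1 c hc).1, (hn.2 c hc).2⟩, ?_, ?_,
      fun η hη => (hNv η hη.1).mono fun n hn c hc => (hn c hc).2⟩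
    · exact tendsto_of_tendsto_of_tendsto_of_le_of_le tendsto_const_nhds hlim
        (fun n => zero_le) fun n => hle n _ _ fun ω ⟨c, hc, h⟩ => ⟨c, hc, Or.inl h⟩
    · exact tendsto_of_tendsto_of_tendsto_of_le_of_le tendsto_const_nhds hlim
        (fun n => zero_le) fun n => hle n _ _ fun ω ⟨c, hc, h⟩ => ⟨c, hc, Or.inr h⟩
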